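/- **Setting.** All topological spaces are $T_0$. A *transitive model* is a transitive class $M$ (a set or a proper class) of the universe $V$ of sets that satisfies ZFC. A space is *Čech complete* if it is a $G_\delta$ subspace of a compact Hausdorff space, and *interpretable* if it is regular Hausdorff and is the image of a Čech complete space under a continuous open map. Let $M$ be a transitive model and let $M\models\langle X,\tau\rangle$ be a topological space. A *preinterpretation* of $X$ over $M$ is a topological space $\langle\hat X,\hat\tau\rangle$ together with a map $\pi$ consisting of a map $\pi\colon X\to\hat X$ on points and a map $\pi\colon\tau\to\hat\tau$ on open sets such that 1. for all $x\in X$ and $O\in\tau$, $x\in O$ if and only if $\pi(x)\in\pi(O)$; 2. $\pi(O\cap P)=\pi(O)\cap\pi(P)$ for all $O,P\in\tau$, and $\pi(\bigcup C)=\bigcup_{O\in C}\pi(O)$ for every $C\in M$ with $C\subseteq\tau$; 3. $\pi(\emptyset)=\emptyset$ and $\pi(X)=\hat X$; 4. $\{\pi(O)\colon O\in\tau\}$ is a basis of $\hat\tau$. If $\pi\colon X\to\hat X$ and $\pi'\colon X\to\hat X'$ are preinterpretations over $M$, a *reduction* of $\pi'$ to $\pi$ is a map $h\colon\hat X'\to\hat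 X$ such that $h(\pi'(x))=\pi(x)$ for all $x\in X$ and $h^{-1}(\pi(O))=\pi'(O)$ for all $O\in\tau$. An *interpretation* of $X$ over $M$ is a preinterpretation $\pi$ over $M$ such that every preinterpretation of $X$ over $M$ has a reduction to $\pi$. **Theorem.** Let $M_0\subseteq M_1$ be transitive models. Suppose that $M_0\models\langle X_0,\tau_0\rangle$ is an interpretable space, that $M_1\models\pi_0\colon\langle X_0,\tau_0\rangle\to\langle X_1,\tau_1\rangle$ is an interpretation over $M_0$ (that is, the space, the maps, the competing preinterpretations and the reductions in the definition are all taken in $M_1$), and that $\pi_1\colon\langle X_1,\tau_1\rangle\to\langle X_2,\tau_2\rangle$ is, in $V$, an interpretation over $M_1$. Then $\pi_1\circ\pi_0\colon\langle X_0,\tau_0\rangle\to\langle X_2,\tau_2\rangle$ (composed on points and on open sets) is, in $V$, an interpretation over $M_0$. -/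

import Mathlib

universe u

open scoped ZFSet

namespace TopInterp

/-! ### Transitive models of ZFC

The universe `V` is `ZFSet.{u}`.  A transitive model is a transitive class `M : Set ZFSet.{u}`
(it may be a set or a proper class) which satisfies every axiom of ZFC. -/

/-- The only non-logical symbol of the language of set theory. -/
inductive MemRel : ℕ → Type
  | mem : MemRel 2

/-- The first-order language of set theory. -/
def setLang : FirstOrder.Language := ⟨fun _ => Empty, MemRel⟩

/-- The structure `(M, ∈)`. -/
instance memStructure (M : Set ZFSet.{u}) : setLang.Structure M where
  funMap := fun f _ => Empty.elim f
  RelMap := fun {_} r =>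
    match r with
    | MemRel.mem => fun v => (v 0 : ZFSet.{u}) ∈ (v 1 : ZFSet.{u})

/-- `M` is a transitive class and `(M, ∈)` satisfies ZFC.  Each field is the satisfaction in
`(M, ∈)` of one axiom or axiom schema; Extensionality and Foundation hold in every transitive
class.  `Set.Definable₁ Set.univ setLang` and `Set.Definable₂ Set.univ setLang` mean: definable
over `(M, ∈)` by a first-order formula with parameters from `M`. -/
structure IsTransitiveModel (M : Set ZFSet.{u}) : Prop where
  transitive : ∀ x ∈ M, ∀ y ∈ x, y ∈ M
  pairing : ∀ x ∈ M, ∀ y ∈ M, ∃ z ∈ M, ∀ w ∈ M, w ∈ z ↔ w = x ∨ w = y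
  union : ∀ x ∈ M, ∃ z ∈ M, ∀ w ∈ M, w ∈ z ↔ ∃ y ∈ x, w ∈ y
  powerset : ∀ x ∈ M, ∃ z ∈ M, ∀ w ∈ M, w ∈ z ↔ w ⊆ x
  infinity : ∃ z ∈ M, ∅ ∈ z ∧ ∀ x ∈ z, insert x x ∈ z
  separation : ∀ D : Set M, Set.Definable₁ Set.univ setLang D →
    ∀ a ∈ M, ∃ b ∈ M, ∀ x : M, (x : ZFSet.{u}) ∈ b ↔ (x : ZFSet.{u}) ∈ a ∧ x ∈ D
  replacement : ∀ R : Set (M × M), Set.Definable₂ Set.univ setLang R →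
    ∀ a ∈ M, (∀ x : M, (x : ZFSet.{u}) ∈ a → ∃! y : M, (x, y) ∈ R) →
      ∃ b ∈ M, ∀ y : M, (y : ZFSet.{u}) ∈ b ↔ ∃ x : M, (x : ZFSet.{u}) ∈ a ∧ (x, y) ∈ R
  choice : ∀ a ∈ M, (∀ x ∈ a, x ≠ ∅) → (∀ x ∈ a, ∀ y ∈ a, x ≠ y → x ∩ y = ∅) →
    ∃ c ∈ M, ∀ x ∈ a, ∃! z, z ∈ x ∧ z ∈ c

/-! ### Functions as sets of ordered pairs -/

/-- The value `f(x)` of a set-theoretic function `f` at a point `x` of its domain. -/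
noncomputable def app (f x : ZFSet.{u}) : ZFSet.{u} :=
  ⋃₀ (ZFSet.sep (fun y => ZFSet.pair x y ∈ f) (⋃₀ (⋃₀ f)))

/-- The composition `g ∘ f`, as a set of ordered pairs contained in `A × C`. -/
noncomputable def comp (A C g f : ZFSet.{u}) : ZFSet.{u} :=
  ZFSet.sep (fun t => ∃ x y z, t = ZFSet.pair x z ∧ ZFSet.pair x y ∈ f ∧ ZFSet.pair y z ∈ g)
    (ZFSet.prod A C)

/-! ### Topological notions relativized to a transitive class `N`

A definition with a class argument `N` is the relativization to `N` of the usual notion, i.e. it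
says `N ⊨ ...`: unbounded quantifiers range over `N`.  Quantifiers bounded by an element of a
transitive `N`, and the set operations used below, need no relativization. -/

/-- `N ⊨ ⟨X, τ⟩` is a `T₀` topological space. -/
structure IsSpace (N : Set ZFSet.{u}) (X τ : ZFSet.{u}) : Prop where
  carrier_mem : X ∈ N
  topology_mem : τ ∈ N
  subset : ∀ O ∈ τ, O ⊆ X
  empty_open : ∅ ∈ τ
  univ_open : X ∈ τ
  inter_open : ∀ O ∈ τ, ∀ P ∈ τ, O ∩ P ∈ τ
  union_open : ∀ C ∈ N, C ⊆ τ → (⋃₀ C : ZFSet.{u}) ∈ τ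
  t0 : ∀ x ∈ X, ∀ y ∈ X, (∀ O ∈ τ, x ∈ O ↔ y ∈ O) → x = y

/-- `⟨X, τ⟩` is Hausdorff. -/
def IsHausdorff (X τ : ZFSet.{u}) : Prop :=
  ∀ x ∈ X, ∀ y ∈ X, x ≠ y → ∃ O ∈ τ, ∃ P ∈ τ, x ∈ O ∧ y ∈ P ∧ O ∩ P = ∅

/-- `⟨X, τ⟩` is regular: a point `x` and a closed set `X \ O` not containing it have disjoint open
neighborhoods. -/
def IsRegular (X τ : ZFSet.{u}) : Prop :=
  ∀ O ∈ τ, ∀ x ∈ O, ∃ P ∈ τ, ∃ Q ∈ τ, x ∈ P ∧ X \ O ⊆ Q ∧ P ∩ Q = ∅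

/-- `N ⊨ D` is finite, i.e. `D` is the image in `N` of a natural number. -/
def IsFin (N : Set ZFSet.{u}) (D : ZFSet.{u}) : Prop :=
  ∃ n ∈ ZFSet.omega.{u}, ∃ e ∈ N, ZFSet.IsFunc n D e ∧ ∀ d ∈ D, ∃ k ∈ n, app e k = d

/-- `N ⊨ ⟨X, τ⟩` is compact. -/
def IsCompactSpace (N : Set ZFSet.{u}) (X τ : ZFSet.{u}) : Prop :=
  ∀ C ∈ N, C ⊆ τ → (⋃₀ C : ZFSet.{u}) = X →
    ∃ D ∈ N, D ⊆ C ∧ IsFin N D ∧ (⋃₀ D : ZFSet.{u}) = X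

/-- `N ⊨ ⟨Y, υ⟩` is Čech complete: there is a compact Hausdorff space `⟨Z, ζ⟩` and a sequence
`g : ω → ζ` of open sets such that `Y = ⋂ₙ g(n)` and `υ` is the subspace topology on `Y`. -/
def IsCechComplete (N : Set ZFSet.{u}) (Y υ : ZFSet.{u}) : Prop :=
  IsSpace N Y υ ∧
  ∃ Z ζ : ZFSet.{u}, IsSpace N Z ζ ∧ IsHausdorff Z ζ ∧ IsCompactSpace N Z ζ ∧
    (∃ g ∈ N, ZFSet.IsFunc ZFSet.omega.{u} ζ g ∧
      ∀ z, z ∈ Y ↔ z ∈ Z ∧ ∀ n ∈ ZFSet.omega.{u}, z ∈ app g n) ∧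
    ∀ U, U ∈ υ ↔ ∃ W ∈ ζ, U = W ∩ Y

/-- `f` is a continuous open surjection from `⟨Y, υ⟩` onto `⟨X, τ⟩`. -/
structure IsOpenContinuousSurjection (Y υ X τ f : ZFSet.{u}) : Prop where
  isFunc : ZFSet.IsFunc Y X f
  surjective : ∀ x ∈ X, ∃ y ∈ Y, app f y = x
  continuous : ∀ O ∈ τ, ZFSet.sep (fun y => app f y ∈ O) Y ∈ υ
  isOpen : ∀ U ∈ υ, ZFSet.sep (fun x => ∃ y ∈ U, app f y = x) X ∈ τ

/-- `N ⊨ ⟨X, τ⟩` is an interpretable space: it is regular Hausdorff and a continuous open image of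
a Čech complete space. -/
def IsInterpretable (N : Set ZFSet.{u}) (X τ : ZFSet.{u}) : Prop :=
  IsSpace N X τ ∧ IsHausdorff X τ ∧ IsRegular X τ ∧
  ∃ Y υ : ZFSet.{u}, IsCechComplete N Y υ ∧ ∃ f ∈ N, IsOpenContinuousSurjection Y υ X τ f

/-! ### Preinterpretations and interpretations

Below, `M ⊆ N` are transitive classes and `M ⊨ ⟨X, τ⟩` is a topological space.  The definitions are
relativized to `N`, the class `M` being used as a predicate.  The case `N = Set.univ` gives the
notions in `V`. -/

/-- `N ⊨` the space `⟨Y, σ⟩` with the maps `p : X → Y` (on points) and `q : τ → σ` (on open sets)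
is a topological preinterpretation of `⟨X, τ⟩` over `M`. -/
structure IsPreinterpretation (N M : Set ZFSet.{u}) (X τ Y σ p q : ZFSet.{u}) : Prop where
  source : IsSpace M X τ
  target : IsSpace N Y σ
  points_mem : p ∈ N
  opens_mem : q ∈ N
  points_isFunc : ZFSet.IsFunc X Y p
  opens_isFunc : ZFSet.IsFunc τ σ q
  mem_iff : ∀ x ∈ X, ∀ O ∈ τ, x ∈ O ↔ app p x ∈ app q O
  map_inter : ∀ O ∈ τ, ∀ P ∈ τ, app q (O ∩ P) = app q O ∩ app q P
  map_union : ∀ C ∈ M, C ⊆ τ → ∀ y, y ∈ app q (⋃₀ C) ↔ ∃ O ∈ C, y ∈ app q O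
  map_empty : app q ∅ = ∅
  map_univ : app q X = Y
  basis : ∀ U ∈ σ, ∀ y ∈ U, ∃ O ∈ τ, y ∈ app q O ∧ app q O ⊆ U

/-- `h : Y₀ → Y₁` is a reduction of the preinterpretation `⟨Y₀, p₀, q₀⟩` of `⟨X, τ⟩` to the
preinterpretation `⟨Y₁, p₁, q₁⟩`. -/
structure IsReduction (X τ Y₀ p₀ q₀ Y₁ p₁ q₁ h : ZFSet.{u}) : Prop where
  isFunc : ZFSet.IsFunc Y₀ Y₁ h
  comp_eq : ∀ x ∈ X, app h (app p₀ x) = app p₁ x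
  preimage_eq : ∀ O ∈ τ, ∀ y ∈ Y₀, app h y ∈ app q₁ O ↔ y ∈ app q₀ O

/-- `N ⊨` the space `⟨Y, σ⟩` with the maps `p, q` is an interpretation of `⟨X, τ⟩` over `M`: a
preinterpretation to which every preinterpretation can be reduced. -/
def IsInterpretation (N M : Set ZFSet.{u}) (X τ Y σ p q : ZFSet.{u}) : Prop :=
  IsPreinterpretation N M X τ Y σ p q ∧
  ∀ Y' σ' p' q' : ZFSet.{u}, IsPreinterpretation N M X τ Y' σ' p' q' →
    ∃ h ∈ N, IsReduction X τ Y' p' q' Y p q h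

end TopInterp

/-! A point of an interpretation of `X` over `M` is the same as a filter of open sets of `X` which
is completely prime with respect to the covers in `M`. Given a preinterpretation of `X₀` over `M₀`,
each of its points yields such a filter on `X₀`, which generates a filter on `X₁`; a point of `X₂`
realizes it as soon as it is completely prime over `M₁`. The filter itself need not belong to `M₁`,
but if some cover in `M₁` refuted primeness, then the filter would yield a sequence of open sets of
the compact Hausdorff space, with each closure contained in the previous set, which avoids an ideal
in `M₁`. The existence of an infinite sequence of this kind is absolute, by well-foundedness of the
tree of attempts, so there is one in `M₁`. Zorn's lemma in `M₁` extends it to a prime filter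
avoiding the ideal, hence gives in `M₁` a completely prime filter on `X₀` over `M₀` which no point
of `X₁` realizes, contradicting that `X₁` is an interpretation in `M₁`. -/

namespace TopInterp

variable {M : Set ZFSet.{u}} {n : ℕ}

/-! ### Definability over a transitive class -/

variable {M : Set ZFSet.{u}} {n : ℕ}

/-- The relation `φ` on `M` is definable over `(M, ∈)` by a formula with parameters. -/
def IsDefinable (M : Set ZFSet.{u}) (φ : (Fin n → M) → Prop) : Prop :=
  (Set.univ : Set M).Definable setLang {v | φ v}

/-- The operation `t` on `M` takes its values in `M` and has a graph definable over `(M, ∈)` with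
parameters. The last variable of the graph is the value. These operations are the terms that may
be substituted in definable relations. -/
structure IsDefinableMap (M : Set ZFSet.{u}) (t : (Fin n → M) → ZFSet.{u}) : Prop where
  mem : ∀ v, t v ∈ M
  graph : IsDefinable M fun w : Fin (n + 1) → M =>
    (w (Fin.last n) : ZFSet.{u}) = t fun i => w i.castSucc

namespace IsDefinable

variable {φ ψ : (Fin n → M) → Prop}

theorem congr (h : IsDefinable M φ) (k : ∀ v, ψ v ↔ φ v) : IsDefinable M ψ := by
  rwa [show ψ = φ from funext fun v => propext (k v)]

theorem and (h : IsDefinable M φ) (k : IsDefinable M ψ) : IsDefinable M fun v => φ v ∧ ψ v :=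
  Set.Definable.inter h k

theorem or (h : IsDefinable M φ) (k : IsDefinable M ψ) : IsDefinable M fun v => φ v ∨ ψ v :=
  Set.Definable.union h k

theorem not (h : IsDefinable M φ) : IsDefinable M fun v => ¬ φ v :=
  Set.Definable.compl h

theorem imp (h : IsDefinable M φ) (k : IsDefinable M ψ) : IsDefinable M fun v => φ v → ψ v :=
  (h.not.or k).congr fun _ => imp_iff_not_or

theorem iff (h : IsDefinable M φ) (k : IsDefinable M ψ) : IsDefinable M fun v => φ v ↔ ψ v :=
  ((h.imp k).and (k.imp h)).congr fun _ => iff_def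

theorem var_eq_var (i j : Fin n) :
    IsDefinable M fun v => (v i : ZFSet.{u}) = v j :=
  Set.definable_iff_exists_formula_sum.2
    ⟨FirstOrder.Language.Term.equal (.var (.inr i)) (.var (.inr j)), by
      ext v; simp [Subtype.coe_inj]⟩

theorem var_eq_const (i : Fin n) (c : M) :
    IsDefinable M fun v => (v i : ZFSet.{u}) = c :=
  Set.definable_iff_exists_formula_sum.2
    ⟨FirstOrder.Language.Term.equal (.var (.inr i)) (.var (.inl ⟨c, trivial⟩)), by
      ext v; simp [Subtype.coe_inj]⟩

theorem var_mem_var (i j : Fin n) :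
    IsDefinable M fun v => (v i : ZFSet.{u}) ∈ (v j : ZFSet.{u}) := by
  let r : setLang.Relations 2 := MemRel.mem
  refine Set.definable_iff_exists_formula_sum.2
    ⟨r.formula₂ (.var (.inr i)) (.var (.inr j)), ?_⟩
  ext v
  simp only [Set.mem_ofPred_eq, FirstOrder.Language.Formula.realize_rel₂,
    FirstOrder.Language.Term.realize_var]
  rfl

theorem subst {k : ℕ} {ρ : (Fin k → M) → Prop} (hρ : IsDefinable M ρ)
    {t : Fin k → (Fin n → M) → M} (ht : ∀ i, IsDefinableMap M fun v => (t i v : ZFSet.{u})) :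
    IsDefinable M fun v => ρ fun i => t i v := by
  have hgraph : (Set.univ : Set M).Definable setLang
      {w : Fin n ⊕ Fin k → M | ∀ i, w (.inr i) = t i (w ∘ .inl)} := by
    rw [Set.ofPred_forall]
    refine Set.definable_iInter_of_finite fun i => ?_
    refine Eq.subst ?_ ((ht i).graph.preimage_comp
      (Fin.snoc (α := fun _ => Fin n ⊕ Fin k) .inl (.inr i)))
    ext w
    simp [Subtype.coe_inj, Function.comp_def]
  refine Eq.subst ?_ ((hgraph.inter (hρ.preimage_comp Sum.inr)).image_comp_sumInl_fin k)
  ext v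
  constructor
  · rintro ⟨w, ⟨hw, hρw⟩, rfl⟩
    have : w ∘ Sum.inr = fun i => t i (w ∘ Sum.inl) := funext hw
    simpa only [Set.mem_preimage, this, Set.mem_ofPred_eq] using hρw
  · exact fun hv => ⟨Sum.elim v fun i => t i v, ⟨fun _ => rfl, hv⟩, rfl⟩

theorem ex {φ : (Fin n → M) → ZFSet.{u} → Prop}
    (h : IsDefinable M fun w : Fin (n + 1) → M => φ (fun i => w i.castSucc) (w (Fin.last n))) :
    IsDefinable M fun v => ∃ x ∈ M, φ v x := by
  refine Eq.subst ?_ (Set.Definable.image_comp h (Fin.castSucc : Fin n → Fin (n + 1)))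
  ext v
  constructor
  · rintro ⟨w, hw, rfl⟩
    exact ⟨w (Fin.last n), Subtype.coe_prop _, hw⟩
  · rintro ⟨x, hx, hφ⟩
    exact ⟨Fin.snoc (α := fun _ => M) v ⟨x, hx⟩, by simpa using hφ, by ext; simp⟩

theorem all {φ : (Fin n → M) → ZFSet.{u} → Prop}
    (h : IsDefinable M fun w : Fin (n + 1) → M => φ (fun i => w i.castSucc) (w (Fin.last n))) :
    IsDefinable M fun v => ∀ x ∈ M, φ v x :=
  (ex (φ := fun v x => ¬ φ v x) h.not).not.congr fun v => by push Not; rfl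

variable {r s t : (Fin n → M) → ZFSet.{u}}

theorem subst₁ {ρ : ZFSet.{u} → Prop} (hρ : IsDefinable M fun v : Fin 1 → M => ρ (v 0))
    (hs : IsDefinableMap M s) : IsDefinable M fun v => ρ (s v) :=
  hρ.subst (t := ![fun v => ⟨s v, hs.mem v⟩]) (Fin.forall_fin_one.2 hs)

theorem subst₂ {ρ : ZFSet.{u} → ZFSet.{u} → Prop}
    (hρ : IsDefinable M fun v : Fin 2 → M => ρ (v 0) (v 1))
    (hs : IsDefinableMap M s) (ht : IsDefinableMap M t) : IsDefinable M fun v => ρ (s v) (t v) :=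
  hρ.subst (t := ![fun v => ⟨s v, hs.mem v⟩, fun v => ⟨t v, ht.mem v⟩])
    (Fin.forall_fin_two.2 ⟨hs, ht⟩)

theorem subst₃ {ρ : ZFSet.{u} → ZFSet.{u} → ZFSet.{u} → Prop}
    (hρ : IsDefinable M fun v : Fin 3 → M => ρ (v 0) (v 1) (v 2))
    (hr : IsDefinableMap M r) (hs : IsDefinableMap M s) (ht : IsDefinableMap M t) :
    IsDefinable M fun v => ρ (r v) (s v) (t v) :=
  hρ.subst (t := ![fun v => ⟨r v, hr.mem v⟩, fun v => ⟨s v, hs.mem v⟩, fun v => ⟨t v, ht.mem v⟩])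
    (Fin.forall_fin_succ.2 ⟨hr, Fin.forall_fin_two.2 ⟨hs, ht⟩⟩)

theorem mem (hs : IsDefinableMap M s) (ht : IsDefinableMap M t) :
    IsDefinable M fun v => s v ∈ t v :=
  subst₂ (ρ := fun x y => x ∈ y) (var_mem_var 0 1) hs ht

theorem eq (hs : IsDefinableMap M s) (ht : IsDefinableMap M t) :
    IsDefinable M fun v => s v = t v :=
  subst₂ (ρ := fun x y => x = y) (var_eq_var 0 1) hs ht

end IsDefinable

namespace IsDefinableMap

theorem var (i : Fin n) : IsDefinableMap M fun v => (v i : ZFSet.{u}) :=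
  ⟨fun v => (v i).2, .var_eq_var _ _⟩

theorem const {c : ZFSet.{u}} (hc : c ∈ M) : IsDefinableMap M fun _ : Fin n → M => c :=
  ⟨fun _ => hc, .var_eq_const _ ⟨c, hc⟩⟩

theorem lift {t : (Fin n → M) → ZFSet.{u}} (ht : IsDefinableMap M t) :
    IsDefinableMap M fun w : Fin (n + 1) → M => t fun i => w i.castSucc := by
  refine ⟨fun w => ht.mem _, ?_⟩
  refine Eq.subst ?_ (ht.graph.preimage_comp
    (Fin.snoc (α := fun _ => Fin (n + 2)) (fun i => i.castSucc.castSucc) (Fin.last (n + 1))))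
  ext w
  simp

end IsDefinableMap

/-! ### Closure properties of transitive models -/

namespace IsTransitiveModel

theorem mem_of_mem (hM : IsTransitiveModel M) {x y : ZFSet.{u}} (h : x ∈ y) (hy : y ∈ M) : x ∈ M :=
  hM.transitive y hy x h

theorem ext (hM : IsTransitiveModel M) {x y : ZFSet.{u}} (hx : x ∈ M) (hy : y ∈ M)
    (h : ∀ z ∈ M, z ∈ x ↔ z ∈ y) : x = y :=
  ZFSet.ext fun z =>
    ⟨fun hz => (h z (hM.mem_of_mem hz hx)).1 hz, fun hz => (h z (hM.mem_of_mem hz hy)).2 hz⟩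

end IsTransitiveModel

namespace IsDefinable

theorem bex (hM : IsTransitiveModel M) {φ : (Fin n → M) → ZFSet.{u} → Prop}
    {a : (Fin n → M) → ZFSet.{u}} (ha : IsDefinableMap M a)
    (h : IsDefinable M fun w : Fin (n + 1) → M => φ (fun i => w i.castSucc) (w (Fin.last n))) :
    IsDefinable M fun v => ∃ x ∈ a v, φ v x :=
  (ex (φ := fun v x => x ∈ a v ∧ φ v x) (.and (.mem (.var _) ha.lift) h)).congr fun v =>
    ⟨fun ⟨x, hx, k⟩ => ⟨x, hM.mem_of_mem hx (ha.mem v), hx, k⟩, fun ⟨x, _, hx, k⟩ => ⟨x, hx, k⟩⟩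

theorem ball (hM : IsTransitiveModel M) {φ : (Fin n → M) → ZFSet.{u} → Prop}
    {a : (Fin n → M) → ZFSet.{u}} (ha : IsDefinableMap M a)
    (h : IsDefinable M fun w : Fin (n + 1) → M => φ (fun i => w i.castSucc) (w (Fin.last n))) :
    IsDefinable M fun v => ∀ x ∈ a v, φ v x :=
  (bex hM (φ := fun v x => ¬ φ v x) ha h.not).not.congr fun v => by push Not; rfl

theorem subset (hM : IsTransitiveModel M) {s t : (Fin n → M) → ZFSet.{u}}
    (hs : IsDefinableMap M s) (ht : IsDefinableMap M t) : IsDefinable M fun v => s v ⊆ t v :=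
  (ball hM (φ := fun v x => x ∈ t v) hs (.mem (.var _) ht.lift)).congr fun _ => Iff.rfl

end IsDefinable

theorem IsDefinableMap.of_mem (hM : IsTransitiveModel M) {t : (Fin n → M) → ZFSet.{u}}
    (ht : ∀ v, t v ∈ M)
    (h : IsDefinable M fun w : Fin (n + 1) → M =>
      (w (Fin.last n) : ZFSet.{u}) ∈ t fun i => w i.castSucc) :
    IsDefinableMap M t := by
  refine ⟨ht, (IsDefinable.all (φ := fun w z => z ∈ (w (Fin.last n) : ZFSet.{u}) ↔
    z ∈ t fun i => w i.castSucc) (.iff (.mem (.var _) (.var _)) ?_)).congr fun w =>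
      ⟨fun e z _ => by rw [e], hM.ext (w _).2 (ht _)⟩⟩
  refine Eq.subst ?_ (h.preimage_comp
    (Fin.snoc (α := fun _ => Fin (n + 2)) (fun i => i.castSucc.castSucc) (Fin.last (n + 1))))
  ext w
  simp

namespace IsTransitiveModel

variable (hM : IsTransitiveModel M) {x y : ZFSet.{u}}
include hM

theorem upair_mem (hx : x ∈ M) (hy : y ∈ M) : ({x, y} : ZFSet.{u}) ∈ M := by
  obtain ⟨z, hz, h⟩ := hM.pairing x hx y hy
  convert hz
  ext w
  rw [ZFSet.mem_pair]
  refine ⟨fun k => (h w ?_).2 k, fun k => (h w (hM.mem_of_mem k hz)).1 k⟩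
  rcases k with rfl | rfl <;> assumption

theorem singleton_mem (hx : x ∈ M) : ({x} : ZFSet.{u}) ∈ M := by
  rw [← ZFSet.pair_eq_singleton]
  exact hM.upair_mem hx hx

theorem pair_mem (hx : x ∈ M) (hy : y ∈ M) : ZFSet.pair x y ∈ M :=
  hM.upair_mem (hM.singleton_mem hx) (hM.upair_mem hx hy)

theorem mem_and_mem_of_pair_mem {z : ZFSet.{u}} (h : ZFSet.pair x y ∈ z) (hz : z ∈ M) :
    x ∈ M ∧ y ∈ M := by
  have hxy : ({x, y} : ZFSet.{u}) ∈ M :=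
    hM.mem_of_mem (y := ZFSet.pair x y) (by simp [ZFSet.pair]) (hM.mem_of_mem h hz)
  exact ⟨hM.mem_of_mem (by simp) hxy, hM.mem_of_mem (by simp) hxy⟩

theorem sUnion_mem (hx : x ∈ M) : (⋃₀ x : ZFSet.{u}) ∈ M := by
  obtain ⟨z, hz, h⟩ := hM.union x hx
  convert hz
  ext w
  rw [ZFSet.mem_sUnion]
  refine ⟨fun k => (h w ?_).2 k, fun k => (h w (hM.mem_of_mem k hz)).1 k⟩
  obtain ⟨y, hy, hw⟩ := k
  exact hM.mem_of_mem hw (hM.mem_of_mem hy hx)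

theorem union_mem (hx : x ∈ M) (hy : y ∈ M) : x ∪ y ∈ M := by
  rw [← ZFSet.sUnion_pair]
  exact hM.sUnion_mem (hM.upair_mem hx hy)

theorem insert_mem (hx : x ∈ M) (hy : y ∈ M) : insert x y ∈ M := by
  rw [ZFSet.insert_eq]
  exact hM.union_mem (hM.singleton_mem hx) hy

theorem empty_mem : ∅ ∈ M := by
  obtain ⟨z, hz, h, -⟩ := hM.infinity
  exact hM.mem_of_mem h hz

theorem sep_mem {φ : ZFSet.{u} → Prop} (h : IsDefinable M fun v : Fin 1 → M => φ (v 0))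
    (hx : x ∈ M) : ZFSet.sep φ x ∈ M := by
  obtain ⟨b, hb, k⟩ := hM.separation {x | φ x} h x hx
  convert hb
  ext z
  rw [ZFSet.mem_sep]
  exact ⟨fun hz => (k ⟨z, hM.mem_of_mem hz.1 hx⟩).2 hz,
    fun hz => (k ⟨z, hM.mem_of_mem hz hb⟩).1 hz⟩

theorem inter_mem (hx : x ∈ M) (hy : y ∈ M) : x ∩ y ∈ M := by
  rw [← ZFSet.sep_mem]
  exact hM.sep_mem (.mem (.var _) (.const hy)) hx

theorem sdiff_mem (hx : x ∈ M) (hy : y ∈ M) : x \ y ∈ M := by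
  rw [← ZFSet.sep_notMem]
  exact hM.sep_mem (.not (.mem (.var _) (.const hy))) hx

theorem sep_powerset_mem (hx : x ∈ M) : ZFSet.sep (· ∈ M) x.powerset ∈ M := by
  obtain ⟨z, hz, h⟩ := hM.powerset x hx
  convert hz
  ext w
  rw [ZFSet.mem_sep, ZFSet.mem_powerset]
  exact ⟨fun k => (h w k.2).2 k.1, fun k => ⟨(h w (hM.mem_of_mem k hz)).1 k, hM.mem_of_mem k hz⟩⟩

theorem sep_powerset_sep_mem {φ : ZFSet.{u} → Prop}
    (h : IsDefinable M fun v : Fin 1 → M => φ (v 0)) (hx : x ∈ M) :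
    ZFSet.sep (fun w => w ∈ M ∧ φ w) x.powerset ∈ M := by
  convert hM.sep_mem h (hM.sep_powerset_mem hx) using 1
  ext w
  simp only [ZFSet.mem_sep, and_assoc]

end IsTransitiveModel

namespace IsDefinableMap

variable (hM : IsTransitiveModel M) {s t : (Fin n → M) → ZFSet.{u}}
include hM

theorem singleton (hs : IsDefinableMap M s) : IsDefinableMap M fun v => {s v} :=
  .of_mem hM (fun v => hM.singleton_mem (hs.mem v))
    ((IsDefinable.eq (.var _) hs.lift).congr fun _ => ZFSet.mem_singleton)

theorem upair (hs : IsDefinableMap M s) (ht : IsDefinableMap M t) :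
    IsDefinableMap M fun v => {s v, t v} :=
  .of_mem hM (fun v => hM.upair_mem (hs.mem v) (ht.mem v))
    ((IsDefinable.or (.eq (.var _) hs.lift) (.eq (.var _) ht.lift)).congr fun _ => ZFSet.mem_pair)

theorem pair (hs : IsDefinableMap M s) (ht : IsDefinableMap M t) :
    IsDefinableMap M fun v => ZFSet.pair (s v) (t v) :=
  .upair hM (.singleton hM hs) (.upair hM hs ht)

theorem sUnion (hs : IsDefinableMap M s) : IsDefinableMap M fun v => (⋃₀ s v : ZFSet.{u}) :=
  .of_mem hM (fun v => hM.sUnion_mem (hs.mem v))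
    ((IsDefinable.bex hM (φ := fun w z => (w (Fin.last n) : ZFSet.{u}) ∈ z) hs.lift
      (.mem (.var _) (.var _))).congr fun _ => ZFSet.mem_sUnion)

theorem union (hs : IsDefinableMap M s) (ht : IsDefinableMap M t) :
    IsDefinableMap M fun v => s v ∪ t v :=
  .sUnion hM (.upair hM hs ht)

theorem insert (hs : IsDefinableMap M s) (ht : IsDefinableMap M t) :
    IsDefinableMap M fun v => Insert.insert (s v) (t v) := by
  simp only [ZFSet.insert_eq]
  exact .union hM (.singleton hM hs) ht

theorem sep {φ : (Fin n → M) → ZFSet.{u} → Prop}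
    (h : IsDefinable M fun w : Fin (n + 1) → M => φ (fun i => w i.castSucc) (w (Fin.last n)))
    (hs : IsDefinableMap M s) : IsDefinableMap M fun v => ZFSet.sep (φ v) (s v) := by
  refine .of_mem hM (fun v => hM.sep_mem ?_ (hs.mem v))
    ((IsDefinable.and (.mem (.var _) hs.lift) h).congr fun _ => ZFSet.mem_sep)
  refine (h.subst (t := Fin.snoc (α := fun _ => (Fin 1 → M) → M) (fun i _ => v i) (· 0))
    (Fin.lastCases ?_ fun i => ?_)).congr fun w => by simp
  · simpa only [Fin.snoc_last] using .var 0
  · simpa only [Fin.snoc_castSucc] using .const (v i).2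

theorem inter (hs : IsDefinableMap M s) (ht : IsDefinableMap M t) :
    IsDefinableMap M fun v => s v ∩ t v := by
  simp only [← ZFSet.sep_mem]
  exact .sep hM (.mem (.var _) ht.lift) hs

end IsDefinableMap

/-! ### Functions in transitive models -/

section Functions

variable {A B f x y : ZFSet.{u}}

theorem mem_app_iff {z : ZFSet.{u}} : z ∈ app f x ↔ ∃ y, ZFSet.pair x y ∈ f ∧ z ∈ y := by
  simp only [app, ZFSet.mem_sUnion, ZFSet.mem_sep]
  constructor
  · rintro ⟨y, ⟨-, hy⟩, hz⟩
    exact ⟨y, hy, hz⟩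
  · rintro ⟨y, hy, hz⟩
    exact ⟨y, ⟨⟨{x, y}, ⟨ZFSet.pair x y, hy, by simp [ZFSet.pair]⟩, by simp⟩, hy⟩, hz⟩

theorem app_eq (hf : ZFSet.IsFunc A B f) (h : ZFSet.pair x y ∈ f) : app f x = y := by
  obtain ⟨z, -, hz⟩ := hf.2 x (ZFSet.pair_mem_prod.1 (hf.1 h)).1
  ext w
  rw [mem_app_iff]
  refine ⟨fun ⟨y', hy', hw⟩ => ?_, fun hw => ⟨y, h, hw⟩⟩
  rwa [hz y h, ← hz y' hy']

theorem pair_mem_iff (hf : ZFSet.IsFunc A B f) (hx : x ∈ A) :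
    ZFSet.pair x y ∈ f ↔ y = app f x := by
  refine ⟨fun h => (app_eq hf h).symm, ?_⟩
  rintro rfl
  obtain ⟨z, hz, -⟩ := hf.2 x hx
  rwa [app_eq hf hz]

theorem app_mem (hf : ZFSet.IsFunc A B f) (hx : x ∈ A) : app f x ∈ B :=
  (ZFSet.pair_mem_prod.1 (hf.1 ((pair_mem_iff hf hx).2 rfl))).2

end Functions

namespace IsTransitiveModel

variable (hM : IsTransitiveModel M) {A B : ZFSet.{u}}
include hM

theorem definable_mem_app {r s t : (Fin n → M) → ZFSet.{u}} (hr : IsDefinableMap M r)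
    (hs : IsDefinableMap M s) (ht : IsDefinableMap M t) :
    IsDefinable M fun v => t v ∈ app (r v) (s v) := by
  refine (IsDefinable.ex (φ := fun v y => ZFSet.pair (s v) y ∈ r v ∧ t v ∈ y)
    (.and (.mem (.pair hM hs.lift (.var _)) hr.lift) (.mem ht.lift (.var _)))).congr fun v => ?_
  rw [mem_app_iff]
  exact ⟨fun ⟨y, hy, h⟩ => ⟨y, (hM.mem_and_mem_of_pair_mem hy (hr.mem v)).2, hy, h⟩,
    fun ⟨y, _, h⟩ => ⟨y, h⟩⟩

theorem app_mem {f x : ZFSet.{u}} (hf : f ∈ M) (hx : x ∈ M) : app f x ∈ M :=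
  hM.sUnion_mem (hM.sep_mem (.mem (.pair hM (.const hx) (.var _)) (.const hf))
    (hM.sUnion_mem (hM.sUnion_mem hf)))

theorem prod_mem (hA : A ∈ M) (hB : B ∈ M) : ZFSet.prod A B ∈ M := by
  have hAB := hM.union_mem hA hB
  convert hM.sep_powerset_sep_mem (φ := fun w => ∃ a ∈ A, ∃ b ∈ B, w = ZFSet.pair a b)
    (.bex hM (.const hA) (.bex hM (.const hB) (.eq (.var _) (.pair hM (.var _) (.var _)))))
    (hM.sep_powerset_mem hAB) using 1
  ext w
  rw [ZFSet.mem_prod, ZFSet.mem_sep]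
  refine ⟨?_, fun h => h.2.2⟩
  rintro ⟨a, ha, b, hb, rfl⟩
  have haM := hM.mem_of_mem ha hA
  have hbM := hM.mem_of_mem hb hB
  refine ⟨ZFSet.mem_powerset.2 fun z hz => ?_, hM.pair_mem haM hbM, a, ha, b, hb, rfl⟩
  simp only [ZFSet.pair, ZFSet.mem_pair, ZFSet.mem_sep, ZFSet.mem_powerset] at hz ⊢
  rcases hz with rfl | rfl
  · refine ⟨fun x hx => ?_, hM.singleton_mem haM⟩
    simp_all
  · refine ⟨fun x hx => ?_, hM.upair_mem haM hbM⟩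
    rcases ZFSet.mem_pair.1 hx with rfl | rfl <;> simp [ha, hb]

theorem exists_isFunc (hA : A ∈ M) (hB : B ∈ M) {ρ : ZFSet.{u} → ZFSet.{u} → Prop}
    (hρ : IsDefinable M fun v : Fin 2 → M => ρ (v 0) (v 1))
    (h : ∀ x ∈ A, ∃! y, y ∈ B ∧ ρ x y) :
    ∃ f ∈ M, ZFSet.IsFunc A B f ∧ ∀ x ∈ A, ρ x (app f x) := by
  let f := ZFSet.sep (fun w => ∃ x ∈ A, ∃ y ∈ B, w = ZFSet.pair x y ∧ ρ x y) (ZFSet.prod A B)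
  have hfM : f ∈ M := hM.sep_mem (.bex hM (.const hA) (.bex hM (.const hB)
    (.and (.eq (.var _) (.pair hM (.var _) (.var _))) (hρ.subst₂ (.var _) (.var _)))))
    (hM.prod_mem hA hB)
  have hpair : ∀ x y, ZFSet.pair x y ∈ f ↔ x ∈ A ∧ y ∈ B ∧ ρ x y := by
    intro x y
    simp only [f, ZFSet.mem_sep, ZFSet.pair_mem_prod, ZFSet.pair_inj]
    exact ⟨fun ⟨_, x', hx, y', hy, ⟨ex, ey⟩, hxy⟩ => ex ▸ ey ▸ ⟨hx, hy, hxy⟩,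
      fun ⟨hx, hy, hxy⟩ => ⟨⟨hx, hy⟩, x, hx, y, hy, ⟨rfl, rfl⟩, hxy⟩⟩
  have hf : ZFSet.IsFunc A B f := ⟨ZFSet.sep_subset, fun x hx =>
    (existsUnique_congr fun y => by rw [hpair, and_iff_right hx]).2 (h x hx)⟩
  exact ⟨f, hfM, hf, fun x hx => ((hpair x _).1 ((pair_mem_iff hf hx).2 rfl)).2.2⟩

theorem exists_isFunc_app_eq (hA : A ∈ M) (hB : B ∈ M) {t : ZFSet.{u} → ZFSet.{u}}
    (ht : IsDefinableMap M fun v : Fin 2 → M => t (v 0)) (htB : ∀ x ∈ A, t x ∈ B) :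
    ∃ f ∈ M, ZFSet.IsFunc A B f ∧ ∀ x ∈ A, app f x = t x :=
  hM.exists_isFunc hA hB (ρ := fun x y => y = t x) (.eq (.var _) ht)
    fun x hx => ⟨t x, ⟨htB x hx, rfl⟩, fun _ hy => hy.2⟩

theorem exists_image (hA : A ∈ M) {ρ : ZFSet.{u} → ZFSet.{u} → Prop}
    (hρ : IsDefinable M fun v : Fin 2 → M => ρ (v 0) (v 1))
    (h : ∀ x ∈ A, ∃! y, y ∈ M ∧ ρ x y) :
    ∃ B ∈ M, ∀ y ∈ M, y ∈ B ↔ ∃ x ∈ A, ρ x y := by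
  obtain ⟨B, hB, k⟩ := hM.replacement {p | ρ p.1 p.2} hρ A hA fun x hx => by
    obtain ⟨y, hy, hy'⟩ := h x hx
    exact ⟨⟨y, hy.1⟩, hy.2, fun z hz => Subtype.ext (hy' z ⟨z.2, hz⟩)⟩
  exact ⟨B, hB, fun y hy => (k ⟨y, hy⟩).trans
    ⟨fun ⟨x, hx, hxy⟩ => ⟨x, hx, hxy⟩, fun ⟨x, hx, hxy⟩ => ⟨⟨x, hM.mem_of_mem hx hA⟩, hx, hxy⟩⟩⟩

theorem exists_coe_eq_of_finite {s : Set ZFSet.{u}} (hs : s.Finite) (hsM : s ⊆ M) :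
    ∃ a ∈ M, (a : Set ZFSet.{u}) = s := by
  induction s, hs using Set.Finite.induction_on with
  | empty => exact ⟨∅, hM.empty_mem, by simp⟩
  | @insert x s _ _ ih =>
    obtain ⟨a, ha, rfl⟩ := ih fun y hy => hsM (Set.mem_insert_of_mem _ hy)
    exact ⟨insert x a, hM.insert_mem (hsM (Set.mem_insert _ _)) ha, by simp⟩

end IsTransitiveModel

theorem IsDefinableMap.app (hM : IsTransitiveModel M) {s t : (Fin n → M) → ZFSet.{u}}
    (hs : IsDefinableMap M s) (ht : IsDefinableMap M t) :
    IsDefinableMap M fun v => app (s v) (t v) :=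
  .of_mem hM (fun v => hM.app_mem (hs.mem v) (ht.mem v))
    (hM.definable_mem_app hs.lift ht.lift (.var _))

/-! ### Natural numbers, finite sets and choice in transitive models -/

/-- The von Neumann natural numbers. -/
noncomputable def nat : ℕ → ZFSet.{u}
  | 0 => ∅
  | k + 1 => insert (nat k) (nat k)

theorem mem_omega_iff {x : ZFSet.{u}} : x ∈ ZFSet.omega.{u} ↔ ∃ k, x = nat k := by
  have mk_ofNat (k : ℕ) : ZFSet.mk (PSet.ofNat k) = nat k := by
    induction k with
    | zero => rfl
    | succ k ih => rw [nat, ← ih]; rfl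
  induction x using Quotient.inductionOn with | _ x => ?_
  constructor
  · rintro ⟨⟨k⟩, hk⟩
    exact ⟨k, by rw [← mk_ofNat]; exact ZFSet.sound hk⟩
  · rintro ⟨k, hk⟩
    exact ⟨⟨k⟩, ZFSet.exact (by rw [← ZFSet.mk_eq, hk]; exact (mk_ofNat k).symm)⟩

theorem nat_mem_omega (k : ℕ) : nat k ∈ ZFSet.omega.{u} := mem_omega_iff.2 ⟨k, rfl⟩

theorem mem_nat_iff {k : ℕ} {x : ZFSet.{u}} : x ∈ nat k ↔ ∃ j < k, x = nat j := by
  induction k with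
  | zero => simp [nat]
  | succ k ih =>
    simp only [nat, ZFSet.mem_insert_iff, ih, Nat.lt_succ_iff_lt_or_eq, or_and_right, exists_or,
      exists_eq_left]
    exact or_comm

theorem nat_injective : Function.Injective nat.{u} :=
  .of_lt_imp_ne fun i j h e => ZFSet.mem_irrefl (nat j) (mem_nat_iff.2 ⟨i, h, e.symm⟩)

theorem exists_eq_nat_iff {x : ZFSet.{u}} :
    (∃ k, x = nat k) ↔ ∀ y ∈ insert x x, y = ∅ ∨ ∃ p ∈ x, y = insert p p := by
  constructor
  · rintro ⟨k, rfl⟩ y hy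
    obtain ⟨_ | j, hj, rfl⟩ := mem_nat_iff.1 (show y ∈ nat (k + 1) from hy)
    · exact .inl rfl
    · exact .inr ⟨nat j, mem_nat_iff.2 ⟨j, by omega, rfl⟩, rfl⟩
  induction x using ZFSet.inductionOn with | _ x ih => ?_
  intro hx
  obtain rfl | ⟨p, hp, hxp⟩ := hx x (ZFSet.mem_insert x x)
  · exact ⟨0, rfl⟩
  obtain ⟨k, rfl⟩ := ih p hp fun y hy => by
    have hyx : y ∈ x := hxp ▸ hy
    obtain h | ⟨q, hq, rfl⟩ := hx y (ZFSet.mem_insert_of_mem x hyx)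
    · exact .inl h
    obtain rfl | hqp := ZFSet.mem_insert_iff.1 (hxp ▸ hq)
    · exact absurd (hxp ▸ hyx) (ZFSet.mem_irrefl _)
    · exact .inr ⟨q, hqp, rfl⟩
  exact ⟨k + 1, hxp⟩

theorem finite_of_forall_exists_app_eq {k D e : ZFSet.{u}} (hk : k ∈ ZFSet.omega.{u})
    (h : ∀ d ∈ D, ∃ j ∈ k, app e j = d) : (D : Set ZFSet.{u}).Finite := by
  obtain ⟨k, rfl⟩ := mem_omega_iff.1 hk
  refine ((Set.finite_Iio k).image fun j => app e (nat j)).subset fun d hd => ?_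
  obtain ⟨_, hj, rfl⟩ := h d hd
  obtain ⟨j, hjk, rfl⟩ := mem_nat_iff.1 hj
  exact ⟨j, hjk, rfl⟩

namespace IsTransitiveModel

variable (hM : IsTransitiveModel M)
include hM

theorem nat_mem (k : ℕ) : nat k ∈ M := by
  induction k with
  | zero => exact hM.empty_mem
  | succ k ih => exact hM.insert_mem ih ih

theorem omega_mem : ZFSet.omega.{u} ∈ M := by
  obtain ⟨z, hz, h0, hs⟩ := hM.infinity
  convert hM.sep_mem
    (φ := fun x => ∀ y ∈ (insert x x : ZFSet.{u}), y = ∅ ∨ ∃ p ∈ x, y = insert p p)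
    (.ball hM (.insert hM (.var _) (.var _)) (.or (.eq (.var _) (.const hM.empty_mem))
      (.bex hM (.var _) (.eq (.var _) (.insert hM (.var _) (.var _)))))) hz using 1
  ext x
  rw [mem_omega_iff, ZFSet.mem_sep, ← exists_eq_nat_iff, iff_and_self]
  rintro ⟨k, rfl⟩
  induction k with
  | zero => exact h0
  | succ k ih => exact hs _ ih

theorem exists_app_nat_eq {A : ZFSet.{u}} (hA : A ∈ M) (k : ℕ) {t : ℕ → ZFSet.{u}}
    (ht : ∀ j < k, t j ∈ A) :
    ∃ e ∈ M, ZFSet.IsFunc (nat k) A e ∧ ∀ j < k, app e (nat j) = t j := by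
  have hpairM : (fun j => ZFSet.pair (nat j) (t j)) '' Set.Iio k ⊆ M := by
    rintro _ ⟨j, hj, rfl⟩
    exact hM.pair_mem (hM.nat_mem j) (hM.mem_of_mem (ht j hj) hA)
  obtain ⟨e, he, hek⟩ := hM.exists_coe_eq_of_finite ((Set.finite_Iio k).image _) hpairM
  have hmem (w : ZFSet.{u}) : w ∈ e ↔ ∃ j < k, ZFSet.pair (nat j) (t j) = w :=
    Set.ext_iff.1 hek w
  have hfunc : ZFSet.IsFunc (nat k) A e := by
    constructor
    · intro w hw
      obtain ⟨j, hj, rfl⟩ := (hmem w).1 hw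
      exact ZFSet.pair_mem_prod.2 ⟨mem_nat_iff.2 ⟨j, hj, rfl⟩, ht j hj⟩
    · intro x hx
      obtain ⟨j, hj, rfl⟩ := mem_nat_iff.1 hx
      refine ⟨t j, (hmem _).2 ⟨j, hj, rfl⟩, fun y hy => ?_⟩
      obtain ⟨i, -, hi⟩ := (hmem _).1 hy
      obtain ⟨hij, rfl⟩ := ZFSet.pair_inj.1 hi
      rw [nat_injective hij]
  exact ⟨e, he, hfunc, fun j hj => app_eq hfunc ((hmem _).2 ⟨j, hj, rfl⟩)⟩

theorem isFin_of_finite {D : ZFSet.{u}} (hD : D ∈ M) (hfin : (D : Set ZFSet.{u}).Finite) :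
    IsFin M D := by
  obtain ⟨k, t, -, ht⟩ := hfin.fin_param
  have hmem (d : ZFSet.{u}) : d ∈ D ↔ ∃ i, t i = d := (Set.ext_iff.1 ht d).symm
  obtain ⟨e, he, hfunc, het⟩ := hM.exists_app_nat_eq hD k
    (t := fun j => if h : j < k then t ⟨j, h⟩ else ∅) fun j hj => by simp [hj, hmem]
  refine ⟨nat k, nat_mem_omega k, e, he, hfunc, fun d hd => ?_⟩
  obtain ⟨i, rfl⟩ := (hmem d).1 hd
  exact ⟨nat i, mem_nat_iff.2 ⟨i, i.2, rfl⟩, by simp [het]⟩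

theorem isFin_iff_finite {D : ZFSet.{u}} (hD : D ∈ M) :
    IsFin M D ↔ (D : Set ZFSet.{u}).Finite :=
  ⟨fun ⟨_, hk, _, _, _, h⟩ => finite_of_forall_exists_app_eq hk h, hM.isFin_of_finite hD⟩

theorem definable_finite :
    IsDefinable M fun v : Fin 1 → M => ((v 0 : ZFSet.{u}) : Set ZFSet.{u}).Finite := by
  refine (IsDefinable.bex hM (φ := fun v k => ∃ e ∈ M, ∀ d ∈ (v 0 : ZFSet.{u}), ∃ j ∈ k,
    app e j = d) (.const hM.omega_mem) (.ex (.ball hM (.var _) (.bex hM (.var _)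
    (.eq (.app hM (.var _) (.var _)) (.var _)))))).congr fun v => ⟨fun h => ?_, ?_⟩
  · obtain ⟨k, hk, e, he, -, h⟩ := hM.isFin_of_finite (v 0).2 h
    exact ⟨k, hk, e, he, h⟩
  · exact fun ⟨k, hk, e, _, h⟩ => finite_of_forall_exists_app_eq hk h

theorem exists_selector {a b : ZFSet.{u}} (ha : a ∈ M) (hb : b ∈ M)
    {ρ : ZFSet.{u} → ZFSet.{u} → Prop} (hρ : IsDefinable M fun v : Fin 2 → M => ρ (v 0) (v 1))
    (h : ∀ x ∈ a, ∃ y ∈ b, ρ x y) :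
    ∃ c ∈ M, ∀ x ∈ a, ∃! y, y ∈ b ∧ ρ x y ∧ ZFSet.pair x y ∈ c := by
  have hab := hM.prod_mem ha hb
  let fiber := fun x => ZFSet.sep (fun w => ∃ y ∈ b, ρ x y ∧ w = ZFSet.pair x y) (ZFSet.prod a b)
  have hfiber : IsDefinableMap M fun v : Fin 1 → M => fiber (v 0) :=
    .sep hM (.bex hM (.const hb) (.and (hρ.subst₂ (.var _) (.var _))
      (.eq (.var _) (.pair hM (.var _) (.var _))))) (.const hab)
  let K := ZFSet.sep (fun w => w ∈ M ∧ ∃ x ∈ a, w = fiber x) (ZFSet.prod a b).powerset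
  have hK (w : ZFSet.{u}) : w ∈ K ↔ ∃ x ∈ a, w = fiber x := by
    refine ZFSet.mem_sep.trans ⟨fun h => h.2.2, ?_⟩
    rintro ⟨x, hx, rfl⟩
    exact ⟨ZFSet.mem_powerset.2 ZFSet.sep_subset, hfiber.mem fun _ => ⟨x, hM.mem_of_mem hx ha⟩,
      x, hx, rfl⟩
  have hKM : K ∈ M := hM.sep_powerset_sep_mem (.bex hM (.const ha)
    (.subst₂ (ρ := fun x w => w = fiber x) hfiber.graph (.var _) (.var _))) hab
  have hpair {x y : ZFSet.{u}} (hx : x ∈ a) (hy : y ∈ b) (hxy : ρ x y) :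
      ZFSet.pair x y ∈ fiber x :=
    ZFSet.mem_sep.2 ⟨ZFSet.pair_mem_prod.2 ⟨hx, hy⟩, y, hy, hxy, rfl⟩
  have hnonempty : ∀ w ∈ K, w ≠ ∅ := by
    intro w hw e
    obtain ⟨x, hx, rfl⟩ := (hK w).1 hw
    obtain ⟨y, hy, hxy⟩ := h x hx
    exact (ZFSet.eq_empty _).1 e _ (hpair hx hy hxy)
  have hdisjoint : ∀ w ∈ K, ∀ w' ∈ K, w ≠ w' → w ∩ w' = ∅ := by
    intro w hw w' hw' hne
    obtain ⟨x, -, rfl⟩ := (hK w).1 hw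
    obtain ⟨x', -, rfl⟩ := (hK w').1 hw'
    refine (ZFSet.eq_empty _).2 fun z hz => hne ?_
    simp only [fiber, ZFSet.mem_inter, ZFSet.mem_sep] at hz
    obtain ⟨⟨-, y, -, -, rfl⟩, -, y', -, -, e⟩ := hz
    rw [(ZFSet.pair_inj.1 e).1]
  obtain ⟨c, hc, hcK⟩ := hM.choice K hKM hnonempty hdisjoint
  refine ⟨c, hc, fun x hx => ?_⟩
  obtain ⟨w, ⟨hw, hwc⟩, hwu⟩ := hcK _ ((hK _).2 ⟨x, hx, rfl⟩)
  obtain ⟨-, y, hy, hxy, rfl⟩ := ZFSet.mem_sep.1 hw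
  exact ⟨y, ⟨hy, hxy, hwc⟩, fun z ⟨hz, hxz, hzc⟩ =>
    (ZFSet.pair_inj.1 (hwu _ ⟨hpair hx hz hxz, hzc⟩)).2⟩

theorem exists_choiceFunction {a b : ZFSet.{u}} (ha : a ∈ M) (hb : b ∈ M)
    {ρ : ZFSet.{u} → ZFSet.{u} → Prop} (hρ : IsDefinable M fun v : Fin 2 → M => ρ (v 0) (v 1))
    (h : ∀ x ∈ a, ∃ y ∈ b, ρ x y) : ∃ c ∈ M, ZFSet.IsFunc a b c ∧ ∀ x ∈ a, ρ x (app c x) := by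
  obtain ⟨s, hs, hsel⟩ := hM.exists_selector ha hb hρ h
  obtain ⟨c, hc, hfunc, hcs⟩ := hM.exists_isFunc ha hb
    (ρ := fun x y => ρ x y ∧ ZFSet.pair x y ∈ s)
    (.and hρ (.mem (.pair hM (.var _) (.var _)) (.const hs))) hsel
  exact ⟨c, hc, hfunc, fun x hx => (hcs x hx).1⟩

end IsTransitiveModel

theorem isTransitiveModel_univ : IsTransitiveModel (Set.univ : Set ZFSet.{u}) where
  transitive _ _ _ _ := trivial
  pairing x _ y _ := ⟨{x, y}, trivial, fun w _ => ZFSet.mem_pair⟩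
  union x _ := ⟨⋃₀ x, trivial, fun w _ => ZFSet.mem_sUnion⟩
  powerset x _ := ⟨x.powerset, trivial, fun w _ => ZFSet.mem_powerset⟩
  infinity := ⟨ZFSet.omega, trivial, ZFSet.omega_zero, fun _ => ZFSet.omega_succ⟩
  separation D _ a _ := ⟨ZFSet.sep (fun x => ⟨x, trivial⟩ ∈ D) a, trivial, fun x => ZFSet.mem_sep⟩
  replacement R _ a _ h := by
    choose f hf hf' using h
    refine ⟨ZFSet.range fun x : Shrink.{u} a =>
      (f ⟨_, trivial⟩ ((equivShrink a).symm x).2 : ZFSet.{u}), trivial, fun y => ?_⟩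
    rw [ZFSet.mem_range]
    constructor
    · rintro ⟨x, hx⟩
      obtain rfl := Subtype.ext hx
      exact ⟨_, ((equivShrink a).symm x).2, hf _ _⟩
    · rintro ⟨x, hx, hxy⟩
      exact ⟨equivShrink a ⟨x, hx⟩, by simp [hf' x hx y hxy]⟩
  choice a _ hne hd := by
    choose! f hf using fun x (hx : x ∈ a) =>
      (ZFSet.nonempty_def x).1 ((ZFSet.eq_empty_or_nonempty x).resolve_left (hne x hx))
    refine ⟨ZFSet.sep (fun z => ∃ x ∈ a, z = f x) (⋃₀ a), trivial, fun x hx => ?_⟩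
    refine ⟨f x, ⟨hf x hx, ZFSet.mem_sep.2
      ⟨ZFSet.mem_sUnion_of_mem (hf x hx) hx, x, hx, rfl⟩⟩, ?_⟩
    rintro z ⟨hz, hz'⟩
    obtain ⟨-, x', hx', rfl⟩ := ZFSet.mem_sep.1 hz'
    by_contra hne
    have hx'x : x' ∩ x = ∅ := hd x' hx' x hx fun e => hne (e ▸ rfl)
    exact (ZFSet.eq_empty _).1 hx'x _ (ZFSet.mem_inter.2 ⟨hf x' hx', hz⟩)

/-! ### Infinite descending sequences in transitive models -/

/-- A partial Mostowski collapse of `R`: its domain is closed under `R`-successors, and each value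
`g(x)` is the set of all `g(x')` with `x R x'`. No functionality is required, since it follows by
`∈`-induction. -/
def IsCollapse (R g : ZFSet.{u}) : Prop :=
  ∀ x y, ZFSet.pair x y ∈ g →
    (∀ x', ZFSet.pair x x' ∈ R → ∃ z ∈ y, ZFSet.pair x' z ∈ g) ∧
    ∀ z ∈ y, ∃ x', ZFSet.pair x x' ∈ R ∧ ZFSet.pair x' z ∈ g

namespace IsCollapse

variable {R g : ZFSet.{u}}

theorem value_unique {g' : ZFSet.{u}} (hg : IsCollapse R g) (hg' : IsCollapse R g')
    {x y y' : ZFSet.{u}} (h : ZFSet.pair x y ∈ g) (h' : ZFSet.pair x y' ∈ g') : y = y' := by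
  induction y using ZFSet.inductionOn generalizing x y' with | _ y ih => ?_
  ext z
  constructor
  · intro hz
    obtain ⟨x', hxx', hxz⟩ := (hg x y h).2 z hz
    obtain ⟨z', hz', hxz'⟩ := (hg' x y' h').1 x' hxx'
    rwa [ih z hz hxz hxz']
  · intro hz
    obtain ⟨x', hxx', hxz⟩ := (hg' x y' h').2 z hz
    obtain ⟨z', hz', hxz'⟩ := (hg x y h).1 x' hxx'
    rwa [← ih z' hz' hxz' hxz]

theorem pair_notMem_of_descending (hg : IsCollapse R g) {s : ℕ → ZFSet.{u}}
    (hs : ∀ k, ZFSet.pair (s k) (s (k + 1)) ∈ R) (k : ℕ) (y : ZFSet.{u}) :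
    ZFSet.pair (s k) y ∉ g := by
  induction y using ZFSet.inductionOn generalizing k with | _ y ih => ?_
  intro h
  obtain ⟨z, hz, hsz⟩ := (hg _ _ h).1 _ (hs k)
  exact ih z hz (k + 1) hsz

theorem insert (hg : IsCollapse R g) {x y : ZFSet.{u}}
    (h : ∀ x', ZFSet.pair x x' ∈ R → ∃ z ∈ y, ZFSet.pair x' z ∈ g)
    (h' : ∀ z ∈ y, ∃ x', ZFSet.pair x x' ∈ R ∧ ZFSet.pair x' z ∈ g) :
    IsCollapse R (insert (ZFSet.pair x y) g) := by
  intro x₁ y₁ h₁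
  suffices hk : (∀ x', ZFSet.pair x₁ x' ∈ R → ∃ z ∈ y₁, ZFSet.pair x' z ∈ g) ∧
      ∀ z ∈ y₁, ∃ x', ZFSet.pair x₁ x' ∈ R ∧ ZFSet.pair x' z ∈ g from
    ⟨fun x' hx' => (hk.1 x' hx').imp fun z hz => ⟨hz.1, ZFSet.mem_insert_of_mem _ hz.2⟩,
      fun z hz => (hk.2 z hz).imp fun x' hx' => ⟨hx'.1, ZFSet.mem_insert_of_mem _ hx'.2⟩⟩
  obtain e | h₁ := ZFSet.mem_insert_iff.1 h₁
  · obtain ⟨rfl, rfl⟩ := ZFSet.pair_inj.1 e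
    exact ⟨h, h'⟩
  · exact hg x₁ y₁ h₁

end IsCollapse

namespace IsTransitiveModel

variable (hM : IsTransitiveModel M) {S R : ZFSet.{u}}
include hM

theorem definable_isCollapse (hR : R ∈ M) :
    IsDefinable M fun v : Fin 1 → M => IsCollapse R (v 0) := by
  refine (IsDefinable.all (φ := fun v x => ∀ y ∈ M, ZFSet.pair x y ∈ (v 0 : ZFSet.{u}) →
    (∀ x' ∈ M, ZFSet.pair x x' ∈ R → ∃ z ∈ y, ZFSet.pair x' z ∈ (v 0 : ZFSet.{u})) ∧
    ∀ z ∈ y, ∃ x' ∈ M, ZFSet.pair x x' ∈ R ∧ ZFSet.pair x' z ∈ (v 0 : ZFSet.{u}))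
    (.all (.imp (.mem (.pair hM (.var _) (.var _)) (.var _)) (.and
      (.all (.imp (.mem (.pair hM (.var _) (.var _)) (.const hR))
        (.bex hM (.var _) (.mem (.pair hM (.var _) (.var _)) (.var _)))))
      (.ball hM (.var _) (.ex (.and (.mem (.pair hM (.var _) (.var _)) (.const hR))
        (.mem (.pair hM (.var _) (.var _)) (.var _))))))))).congr fun v => ?_
  have hpair {x y g : ZFSet.{u}} (hg : g ∈ M) (h : ZFSet.pair x y ∈ g) : x ∈ M ∧ y ∈ M :=
    hM.mem_and_mem_of_pair_mem h hg
  constructor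
  · exact fun h x _ y _ hxy => ⟨fun x' _ => (h x y hxy).1 x', fun z hz =>
      ((h x y hxy).2 z hz).imp fun x' hx' => ⟨(hpair hR hx'.1).2, hx'⟩⟩
  · intro h x y hxy
    obtain ⟨hsucc, hval⟩ := h x (hpair (v 0).2 hxy).1 y (hpair (v 0).2 hxy).2 hxy
    exact ⟨fun x' hx' => hsucc x' (hpair hR hx').2 hx',
      fun z hz => (hval z hz).imp fun _ => And.right⟩

theorem exists_greatest_collapse (hS : S ∈ M) (hR : R ∈ M) (hRS : R ⊆ ZFSet.prod S S) :
    ∃ f ∈ M, IsCollapse R f ∧ ∀ g ∈ M, IsCollapse R g →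
      ∀ x ∈ S, ∀ y, ZFSet.pair x y ∈ g → ZFSet.pair x y ∈ f := by
  let φ : ZFSet.{u} → ZFSet.{u} → Prop := fun x y => ∃ g ∈ M, IsCollapse R g ∧ ZFSet.pair x y ∈ g
  have hφ : IsDefinable M fun v : Fin 2 → M => φ (v 0) (v 1) :=
    .ex (.and (.subst₁ (ρ := IsCollapse R) (hM.definable_isCollapse hR) (.var _))
      (.mem (.pair hM (.var _) (.var _)) (.var _)))
  let B := ZFSet.sep (fun x => ∃ y ∈ M, φ x y) S
  have hB : B ∈ M := hM.sep_mem (.ex hφ) hS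
  obtain ⟨Y, hY, hYB⟩ := hM.exists_image hB hφ fun x hx => by
    obtain ⟨-, y, hy, g, hg, hgR, hxy⟩ := ZFSet.mem_sep.1 hx
    exact ⟨y, ⟨hy, g, hg, hgR, hxy⟩,
      fun y' ⟨_, g', _, hgR', hxy'⟩ => hgR'.value_unique hgR hxy' hxy⟩
  let f := ZFSet.sep (fun w => ∃ x ∈ B, ∃ y ∈ Y, w = ZFSet.pair x y ∧ φ x y) (ZFSet.prod B Y)
  have hf : f ∈ M := hM.sep_mem (.bex hM (.const hB) (.bex hM (.const hY)
    (.and (.eq (.var _) (.pair hM (.var _) (.var _))) (hφ.subst₂ (.var _) (.var _)))))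
    (hM.prod_mem hB hY)
  have hpair (x y : ZFSet.{u}) : ZFSet.pair x y ∈ f ↔ x ∈ S ∧ φ x y := by
    simp only [f, ZFSet.mem_sep, ZFSet.pair_mem_prod, ZFSet.pair_inj]
    constructor
    · rintro ⟨⟨hx, -⟩, _, -, _, -, ⟨rfl, rfl⟩, hxy⟩
      exact ⟨(ZFSet.mem_sep.1 hx).1, hxy⟩
    · rintro ⟨hx, g, hg, hgR, hxy⟩
      have hy := (hM.mem_and_mem_of_pair_mem hxy hg).2
      have hxB : x ∈ B := ZFSet.mem_sep.2 ⟨hx, y, hy, g, hg, hgR, hxy⟩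
      have hyY : y ∈ Y := (hYB y hy).2 ⟨x, hxB, g, hg, hgR, hxy⟩
      exact ⟨⟨hxB, hyY⟩, x, hxB, y, hyY, ⟨rfl, rfl⟩, g, hg, hgR, hxy⟩
  refine ⟨f, hf, fun x y h => ?_, fun g hg hgR x hx y hxy => (hpair x y).2 ⟨hx, g, hg, hgR, hxy⟩⟩
  obtain ⟨-, g, hg, hgR, hxy⟩ := (hpair x y).1 h
  have hgf {x' z : ZFSet.{u}} (hx' : ZFSet.pair x x' ∈ R) (h : ZFSet.pair x' z ∈ g) :
      ZFSet.pair x' z ∈ f :=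
    (hpair x' z).2 ⟨(ZFSet.pair_mem_prod.1 (hRS hx')).2, g, hg, hgR, h⟩
  exact ⟨fun x' hx' => ((hgR x y hxy).1 x' hx').imp fun z hz => ⟨hz.1, hgf hx' hz.2⟩,
    fun z hz => ((hgR x y hxy).2 z hz).imp fun x' hx' => ⟨hx'.1, hgf hx'.1 hx'.2⟩⟩

theorem exists_pruned (hS : S ∈ M) (hR : R ∈ M) (hRS : R ⊆ ZFSet.prod S S) {s : ℕ → ZFSet.{u}}
    (hs : ∀ k, ZFSet.pair (s k) (s (k + 1)) ∈ R) :
    ∃ A ∈ M, s 0 ∈ A ∧ ∀ x ∈ A, ∃ y ∈ A, ZFSet.pair x y ∈ R := by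
  obtain ⟨f, hf, hfR, hmax⟩ := hM.exists_greatest_collapse hS hR hRS
  refine ⟨ZFSet.sep (fun x => ∀ z ∈ M, ZFSet.pair x z ∉ f) S, hM.sep_mem
    (.all (.not (.mem (.pair hM (.var _) (.var _)) (.const hf)))) hS, ?_, fun x hx => ?_⟩
  · exact ZFSet.mem_sep.2 ⟨(ZFSet.pair_mem_prod.1 (hRS (hs 0))).1,
      fun z _ => hfR.pair_notMem_of_descending hs 0 z⟩
  obtain ⟨hxS, hxf⟩ := ZFSet.mem_sep.1 hx
  by_contra! hterm
  have hxM := hM.mem_of_mem hxS hS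
  let y := ZFSet.sep (fun z => ∃ x' ∈ S, ZFSet.pair x x' ∈ R ∧ ZFSet.pair x' z ∈ f) (⋃₀ (⋃₀ f))
  have hy : y ∈ M := hM.sep_mem (.bex hM (.const hS)
    (.and (.mem (.pair hM (.const hxM) (.var _)) (.const hR))
      (.mem (.pair hM (.var _) (.var _)) (.const hf)))) (hM.sUnion_mem (hM.sUnion_mem hf))
  refine hxf y hy (hmax _ (hM.insert_mem (hM.pair_mem hxM hy) hf) (hfR.insert ?_ ?_) x hxS y
    (ZFSet.mem_insert _ _))
  · intro x' hx'
    have hx'S := (ZFSet.pair_mem_prod.1 (hRS hx')).2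
    obtain ⟨z, -, hz⟩ : ∃ z ∈ M, ZFSet.pair x' z ∈ f := by
      by_contra! hx'f
      exact hterm x' (ZFSet.mem_sep.2 ⟨hx'S, hx'f⟩) hx'
    refine ⟨z, ZFSet.mem_sep.2 ⟨?_, x', hx'S, hx', hz⟩, hz⟩
    exact ZFSet.mem_sUnion_of_mem (z := {x', z}) (by simp)
      (ZFSet.mem_sUnion_of_mem (z := ZFSet.pair x' z) (by simp [ZFSet.pair]) hz)
  · intro z hz
    obtain ⟨-, x', -, hx'⟩ := ZFSet.mem_sep.1 hz
    exact ⟨x', hx'⟩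

end IsTransitiveModel

namespace IsTransitiveModel

variable (hM : IsTransitiveModel M) {S R : ZFSet.{u}}
include hM

theorem exists_orbit {A c x₀ : ZFSet.{u}} (hA : A ∈ M) (hc : c ∈ M) (hcA : ZFSet.IsFunc A A c)
    (hx₀ : x₀ ∈ A) : ∃ b ∈ M, ∀ x, x ∈ b ↔ ∃ k, x = (app c)^[k] x₀ := by
  have horbit (k : ℕ) : (app c)^[k] x₀ ∈ A := by
    induction k with
    | zero => exact hx₀
    | succ k ih => simpa only [Function.iterate_succ_apply'] using TopInterp.app_mem hcA ih
  refine ⟨ZFSet.sep (fun x => ∃ k ∈ ZFSet.omega.{u}, ∃ e ∈ M, app e ∅ = x₀ ∧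
    (∀ j ∈ k, app e (insert j j) = app c (app e j)) ∧ x = app e k) A, hM.sep_mem
    (.bex hM (.const hM.omega_mem) (.ex (.and
      (.eq (.app hM (.var _) (.const hM.empty_mem)) (.const (hM.mem_of_mem hx₀ hA)))
      (.and (.ball hM (.var _) (.eq (.app hM (.var _) (.insert hM (.var _) (.var _)))
        (.app hM (.const hc) (.app hM (.var _) (.var _)))))
        (.eq (.var _) (.app hM (.var _) (.var _))))))) hA, fun x => ?_⟩
  rw [ZFSet.mem_sep]
  constructor
  · rintro ⟨-, k, hk, e, -, he₀, he, rfl⟩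
    obtain ⟨k, rfl⟩ := mem_omega_iff.1 hk
    have hiter (j : ℕ) (hj : j ≤ k) : app e (nat j) = (app c)^[j] x₀ := by
      induction j with
      | zero => exact he₀
      | succ j ih =>
        rw [Function.iterate_succ_apply', ← ih (by omega)]
        exact he (nat j) (mem_nat_iff.2 ⟨j, hj, rfl⟩)
    exact ⟨k, hiter k le_rfl⟩
  · rintro ⟨k, rfl⟩
    obtain ⟨e, he, -, het⟩ := hM.exists_app_nat_eq hA (k + 1) fun j _ => horbit j
    refine ⟨horbit k, nat k, nat_mem_omega k, e, he, het 0 (by omega), fun j hj => ?_,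
      (het k (by omega)).symm⟩
    obtain ⟨j, hjk, rfl⟩ := mem_nat_iff.1 hj
    rw [het j (by omega), ← Function.iterate_succ_apply' (app c)]
    exact het (j + 1) (by omega)

theorem exists_descending (hS : S ∈ M) (hR : R ∈ M) (hRS : R ⊆ ZFSet.prod S S)
    {s : ℕ → ZFSet.{u}} (hs : ∀ k, ZFSet.pair (s k) (s (k + 1)) ∈ R) :
    ∃ t : ℕ → ZFSet.{u}, t 0 = s 0 ∧ (∀ k, ZFSet.pair (t k) (t (k + 1)) ∈ R) ∧
      ∃ b ∈ M, ∀ x, x ∈ b ↔ ∃ k, x = t k := by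
  obtain ⟨A, hA, h₀, hsucc⟩ := hM.exists_pruned hS hR hRS hs
  obtain ⟨c, hc, hcA, hcR⟩ := hM.exists_choiceFunction hA hA
    (ρ := fun x y => ZFSet.pair x y ∈ R) (.mem (.pair hM (.var _) (.var _)) (.const hR)) hsucc
  obtain ⟨b, hb, hbt⟩ := hM.exists_orbit hA hc hcA h₀
  refine ⟨fun k => (app c)^[k] (s 0), rfl, fun k => ?_, b, hb, hbt⟩
  suffices h : (app c)^[k] (s 0) ∈ A by
    simpa only [Function.iterate_succ_apply'] using hcR _ h
  induction k with
  | zero => exact h₀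
  | succ k ih => simpa only [Function.iterate_succ_apply'] using TopInterp.app_mem hcA ih

theorem exists_range_snd_mem (hS : S ∈ M) {b : ZFSet.{u}} (hb : b ∈ M) {t : ℕ → ZFSet.{u}}
    (htS : ∀ k, t k ∈ S) (hbt : ∀ w, w ∈ b ↔ ∃ k, w = ZFSet.pair (nat k) (t k)) :
    ∃ c ∈ M, ∀ x, x ∈ c ↔ ∃ k, x = t k := by
  refine ⟨ZFSet.sep (fun x => ∃ k ∈ ZFSet.omega.{u}, ZFSet.pair k x ∈ b) S, hM.sep_mem
    (.bex hM (.const hM.omega_mem) (.mem (.pair hM (.var _) (.var _)) (.const hb))) hS,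
    fun x => ?_⟩
  simp only [ZFSet.mem_sep, hbt, ZFSet.pair_inj]
  constructor
  · rintro ⟨-, _, -, k, -, rfl⟩
    exact ⟨k, rfl⟩
  · rintro ⟨k, rfl⟩
    exact ⟨htS k, nat k, nat_mem_omega k, k, rfl, rfl⟩

theorem exists_path {ρ : ZFSet.{u} → ZFSet.{u} → ZFSet.{u} → Prop} (hS : S ∈ M)
    (hρ : IsDefinable M fun v : Fin 3 → M => ρ (v 0) (v 1) (v 2)) {s : ℕ → ZFSet.{u}}
    (hsS : ∀ k, s k ∈ S) (hs : ∀ k, ρ (nat k) (s k) (s (k + 1))) :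
    ∃ t : ℕ → ZFSet.{u}, t 0 = s 0 ∧ (∀ k, t k ∈ S) ∧ (∀ k, ρ (nat k) (t k) (t (k + 1))) ∧
      ∃ b ∈ M, ∀ x, x ∈ b ↔ ∃ k, x = t k := by
  have hω := hM.omega_mem
  let E := ZFSet.prod ZFSet.omega S
  let R := ZFSet.sep (fun w => ∃ k ∈ ZFSet.omega.{u}, ∃ x ∈ S, ∃ y ∈ S,
    w = ZFSet.pair (ZFSet.pair k x) (ZFSet.pair (insert k k) y) ∧ ρ k x y) (ZFSet.prod E E)
  have hE : E ∈ M := hM.prod_mem hω hS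
  have hR : R ∈ M := hM.sep_mem (.bex hM (.const hω) (.bex hM (.const hS) (.bex hM (.const hS)
    (.and (.eq (.var _) (.pair hM (.pair hM (.var _) (.var _))
      (.pair hM (.insert hM (.var _) (.var _)) (.var _))))
      (.subst₃ (ρ := ρ) hρ (.var _) (.var _) (.var _)))))) (hM.prod_mem hE hE)
  have hsR (k : ℕ) :
      ZFSet.pair (ZFSet.pair (nat k) (s k)) (ZFSet.pair (nat (k + 1)) (s (k + 1))) ∈ R :=
    ZFSet.mem_sep.2 ⟨by simp only [E, ZFSet.pair_mem_prod, nat_mem_omega, hsS, and_self],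
      nat k, nat_mem_omega k, s k, hsS k, s (k + 1), hsS (k + 1), rfl, hs k⟩
  obtain ⟨T, hT₀, hT, b, hb, hbT⟩ := hM.exists_descending hE hR ZFSet.sep_subset hsR
  have hpair (k : ℕ) : ∃ x ∈ S, T k = ZFSet.pair (nat k) x := by
    induction k with
    | zero => exact ⟨s 0, hsS 0, hT₀⟩
    | succ k ih =>
      obtain ⟨x, -, hx⟩ := ih
      obtain ⟨-, j, -, x', -, y, hy, e, -⟩ := ZFSet.mem_sep.1 (hT k)
      obtain ⟨e₁, e₂⟩ := ZFSet.pair_inj.1 e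
      obtain ⟨rfl, -⟩ := ZFSet.pair_inj.1 (hx.symm.trans e₁)
      exact ⟨y, hy, e₂⟩
  choose t htS ht using hpair
  refine ⟨t, (ZFSet.pair_inj.1 ((ht 0).symm.trans hT₀)).2, htS, fun k => ?_,
    hM.exists_range_snd_mem hS hb htS fun w => by simp only [hbT, ht]⟩
  obtain ⟨-, j, -, x, -, y, -, e, h⟩ := ZFSet.mem_sep.1 (hT k)
  simp only [ht, ZFSet.pair_inj] at e
  obtain ⟨⟨rfl, rfl⟩, -, rfl⟩ := e
  exact h

end IsTransitiveModel

/-! ### Zorn's lemma in transitive models -/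

/-- `K` is a chain with respect to inclusion. -/
def IsChainSet (K : ZFSet.{u}) : Prop := ∀ x ∈ K, ∀ y ∈ K, x ⊆ y ∨ y ⊆ x

/-- `B` contains `F₀` and is closed under the function `c` and under unions of nonempty chains that
belong to `M`. -/
structure IsTowerClosed (M : Set ZFSet.{u}) (c F₀ B : ZFSet.{u}) : Prop where
  base_mem : F₀ ∈ B
  app_mem : ∀ x ∈ B, app c x ∈ B
  sUnion_mem : ∀ K ∈ M, K ⊆ B → IsChainSet K → K ≠ ∅ → (⋃₀ K : ZFSet.{u}) ∈ B

/-- The least tower-closed subset of `𝓕` in `M`, provided that `𝓕` is tower-closed. -/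
noncomputable def tower (M : Set ZFSet.{u}) (c F₀ 𝓕 : ZFSet.{u}) : ZFSet.{u} :=
  ZFSet.sep (fun x => ∀ B ∈ M, IsTowerClosed M c F₀ B → x ∈ B) 𝓕

/-- The notion of an extreme point in the proof of the Bourbaki–Witt theorem: `c` maps every element
of the tower strictly below `e` to a subset of `e`. -/
def IsExtreme (M : Set ZFSet.{u}) (c F₀ 𝓕 e : ZFSet.{u}) : Prop :=
  ∀ x ∈ tower M c F₀ 𝓕, x ⊆ e → x ≠ e → app c x ⊆ e

namespace IsTransitiveModel

variable (hM : IsTransitiveModel M)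
include hM

theorem definable_isChainSet : IsDefinable M fun v : Fin 1 → M => IsChainSet (v 0) :=
  (IsDefinable.ball hM (φ := fun v x => ∀ y ∈ (v 0 : ZFSet.{u}), x ⊆ y ∨ y ⊆ x) (.var _)
    (.ball hM (.var _) (.or (.subset hM (.var _) (.var _)) (.subset hM (.var _) (.var _))))).congr
      fun _ => Iff.rfl

theorem definable_isTowerClosed {c F₀ : ZFSet.{u}} (hc : c ∈ M) (hF₀ : F₀ ∈ M) :
    IsDefinable M fun v : Fin 1 → M => IsTowerClosed M c F₀ (v 0) :=
  (IsDefinable.and (.mem (.const hF₀) (.var 0)) (.and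
    (.ball hM (φ := fun v x => app c x ∈ (v 0 : ZFSet.{u})) (.var _)
      (.mem (.app hM (.const hc) (.var _)) (.var _)))
    (.all (φ := fun v K => K ⊆ (v 0 : ZFSet.{u}) → IsChainSet K → ¬ K = ∅ →
      (⋃₀ K : ZFSet.{u}) ∈ (v 0 : ZFSet.{u}))
      (.imp (.subset hM (.var _) (.var _)) (.imp (.subst₁ hM.definable_isChainSet (.var _))
        (.imp (.not (.eq (.var _) (.const hM.empty_mem)))
          (.mem (.sUnion hM (.var _)) (.var _)))))))).congr
    fun _ => ⟨fun h => ⟨h.1, h.2, h.3⟩, fun h => ⟨h.1, h.2.1, h.2.2⟩⟩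

theorem tower_mem {c F₀ 𝓕 : ZFSet.{u}} (hc : c ∈ M) (hF₀ : F₀ ∈ M) (h𝓕 : 𝓕 ∈ M) :
    tower M c F₀ 𝓕 ∈ M :=
  hM.sep_mem (.all (.imp (.subst₁ (hM.definable_isTowerClosed hc hF₀) (.var _))
    (.mem (.var _) (.var _)))) h𝓕

end IsTransitiveModel

namespace IsTowerClosed

variable {c F₀ 𝓕 : ZFSet.{u}} (h : IsTowerClosed M c F₀ 𝓕)
include h

theorem tower_isTowerClosed : IsTowerClosed M c F₀ (tower M c F₀ 𝓕) where
  base_mem := ZFSet.mem_sep.2 ⟨h.base_mem, fun _ _ hB => hB.base_mem⟩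
  app_mem x hx := by
    obtain ⟨hx𝓕, hx⟩ := ZFSet.mem_sep.1 hx
    exact ZFSet.mem_sep.2 ⟨h.app_mem x hx𝓕, fun B hBM hB => hB.app_mem x (hx B hBM hB)⟩
  sUnion_mem K hK hKT hchain hne := ZFSet.mem_sep.2
    ⟨h.sUnion_mem K hK (fun _ hx => (ZFSet.mem_sep.1 (hKT hx)).1) hchain hne, fun B hBM hB =>
      hB.sUnion_mem K hK (fun _ hx => (ZFSet.mem_sep.1 (hKT hx)).2 B hBM hB) hchain hne⟩

variable (hM : IsTransitiveModel M) (h𝓕 : 𝓕 ∈ M) (hc : c ∈ M)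
include hM h𝓕 hc

theorem tower_induction {ψ : ZFSet.{u} → Prop}
    (hψ : IsDefinable M fun v : Fin 1 → M => ψ (v 0)) (base : ψ F₀)
    (step : ∀ x ∈ tower M c F₀ 𝓕, ψ x → ψ (app c x))
    (limit : ∀ K ∈ M, K ⊆ tower M c F₀ 𝓕 → IsChainSet K → K ≠ ∅ → (∀ x ∈ K, ψ x) →
      ψ (⋃₀ K : ZFSet.{u})) : ∀ x ∈ tower M c F₀ 𝓕, ψ x := by
  have hT := h.tower_isTowerClosed
  have hTM := hM.tower_mem hc (hM.mem_of_mem h.base_mem h𝓕) h𝓕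
  have hsep : IsTowerClosed M c F₀ (ZFSet.sep ψ (tower M c F₀ 𝓕)) :=
    { base_mem := ZFSet.mem_sep.2 ⟨hT.base_mem, base⟩
      app_mem := fun x hx => by
        obtain ⟨hxT, hx⟩ := ZFSet.mem_sep.1 hx
        exact ZFSet.mem_sep.2 ⟨hT.app_mem x hxT, step x hxT hx⟩
      sUnion_mem := fun K hK hKsep hchain hne => by
        have hKT : K ⊆ tower M c F₀ 𝓕 := fun _ hx => (ZFSet.mem_sep.1 (hKsep hx)).1
        exact ZFSet.mem_sep.2 ⟨hT.sUnion_mem K hK hKT hchain hne,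
          limit K hK hKT hchain hne fun _ hx => (ZFSet.mem_sep.1 (hKsep hx)).2⟩ }
  intro x hx
  exact (ZFSet.mem_sep.1 ((ZFSet.mem_sep.1 hx).2 _ (hM.sep_mem hψ hTM) hsep)).2

variable (hsub : ∀ x ∈ tower M c F₀ 𝓕, x ⊆ app c x)
include hsub

theorem base_subset : ∀ x ∈ tower M c F₀ 𝓕, F₀ ⊆ x := by
  refine h.tower_induction hM h𝓕 hc
    (.subset hM (.const (hM.mem_of_mem h.base_mem h𝓕)) (.var _)) subset_rfl
    (fun x hx hF₀ => hF₀.trans (hsub _ hx)) ?_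
  intro K _ _ _ hne hF₀ z hz
  obtain ⟨x, hx⟩ := (ZFSet.eq_empty_or_nonempty K).resolve_left hne
  exact ZFSet.mem_sUnion_of_mem (hF₀ x hx hz) hx

theorem subset_or_app_subset {e : ZFSet.{u}} (he : e ∈ tower M c F₀ 𝓕)
    (hext : IsExtreme M c F₀ 𝓕 e) : ∀ x ∈ tower M c F₀ 𝓕, x ⊆ e ∨ app c e ⊆ x := by
  have heM : e ∈ M := hM.mem_of_mem (ZFSet.mem_sep.1 he).1 h𝓕
  refine h.tower_induction hM h𝓕 hc (.or (.subset hM (.var _) (.const heM))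
    (.subset hM (.app hM (.const hc) (.const heM)) (.var _)))
    (.inl (h.base_subset hM h𝓕 hc hsub e he)) ?_ ?_
  · rintro x hx (hxe | hex)
    · by_cases heq : x = e
      · exact .inr (heq ▸ subset_rfl)
      · exact .inl (hext x hx hxe heq)
    · exact .inr (hex.trans (hsub _ hx))
  · intro K _ _ _ _ hK
    by_cases hle : ∀ x ∈ K, x ⊆ e
    · refine .inl fun z hz => ?_
      obtain ⟨x, hx, hzx⟩ := ZFSet.mem_sUnion.1 hz
      exact hle x hx hzx
    · push Not at hle
      obtain ⟨x, hx, hxe⟩ := hle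
      exact .inr fun z hz => ZFSet.mem_sUnion_of_mem ((hK x hx).resolve_left hxe hz) hx

theorem isExtreme_app {e : ZFSet.{u}} (he : e ∈ tower M c F₀ 𝓕) (hext : IsExtreme M c F₀ 𝓕 e) :
    IsExtreme M c F₀ 𝓕 (app c e) := by
  intro x hx hxe hne
  rcases h.subset_or_app_subset hM h𝓕 hc hsub he hext x hx with hle | hge
  · by_cases heq : x = e
    · rw [heq]
    · exact (hext x hx hle heq).trans (hsub _ he)
  · exact absurd (subset_antisymm hxe hge) hne

theorem isExtreme_sUnion {K : ZFSet.{u}} (hK : K ∈ M) (hKT : K ⊆ tower M c F₀ 𝓕)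
    (hchain : IsChainSet K) (hKne : K ≠ ∅) (hext : ∀ e ∈ K, IsExtreme M c F₀ 𝓕 e) :
    IsExtreme M c F₀ 𝓕 (⋃₀ K : ZFSet.{u}) := by
  intro x hx hxK hne
  obtain ⟨k, hk, hkx⟩ : ∃ k ∈ K, ¬ app c k ⊆ x := by
    by_contra! hall
    refine hne (subset_antisymm hxK fun z hz => ?_)
    obtain ⟨k, hk, hzk⟩ := ZFSet.mem_sUnion.1 hz
    exact hall k hk (hsub k (hKT hk) hzk)
  have hxk := (h.subset_or_app_subset hM h𝓕 hc hsub (hKT hk) (hext k hk) x hx).resolve_right hkx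
  by_cases heq : x = k
  · subst heq
    exact (h.subset_or_app_subset hM h𝓕 hc hsub hx (hext x hk) _
      (h.tower_isTowerClosed.sUnion_mem K hK hKT hchain hKne)).resolve_left
        fun hle => hne (subset_antisymm hxK hle)
  · exact fun z hz => ZFSet.mem_sUnion_of_mem (hext k hk x hx hxk heq hz) hk

theorem isExtreme : ∀ e ∈ tower M c F₀ 𝓕, IsExtreme M c F₀ 𝓕 e := by
  have hTM := hM.tower_mem hc (hM.mem_of_mem h.base_mem h𝓕) h𝓕
  refine h.tower_induction hM h𝓕 hc (.ball hM
    (φ := fun v x => x ⊆ (v 0 : ZFSet.{u}) → ¬ x = v 0 → app c x ⊆ v 0) (.const hTM)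
    (.imp (.subset hM (.var _) (.var _)) (.imp (.not (.eq (.var _) (.var _)))
      (.subset hM (.app hM (.const hc) (.var _)) (.var _))))) ?_ ?_ ?_
  · exact fun x hx hle hne => absurd (subset_antisymm hle (h.base_subset hM h𝓕 hc hsub x hx)) hne
  · exact fun e he hext => h.isExtreme_app hM h𝓕 hc hsub he hext
  · exact fun K hK hKT hchain hne hext => h.isExtreme_sUnion hM h𝓕 hc hsub hK hKT hchain hne hext

theorem isChainSet_tower : IsChainSet (tower M c F₀ 𝓕) := by
  intro x hx e he
  exact (h.subset_or_app_subset hM h𝓕 hc hsub he (h.isExtreme hM h𝓕 hc hsub e he) x hx).imp_right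
    (hsub e he).trans

/-- The Bourbaki–Witt theorem in `M`, for families of sets ordered by inclusion. -/
theorem exists_app_eq_self : ∃ x ∈ 𝓕, app c x = x := by
  have hT := h.tower_isTowerClosed
  have htop : (⋃₀ tower M c F₀ 𝓕 : ZFSet.{u}) ∈ tower M c F₀ 𝓕 :=
    hT.sUnion_mem _ (hM.tower_mem hc (hM.mem_of_mem h.base_mem h𝓕) h𝓕) subset_rfl
      (h.isChainSet_tower hM h𝓕 hc hsub) fun hT₀ => ZFSet.notMem_empty _ (hT₀ ▸ hT.base_mem)
  exact ⟨_, (ZFSet.mem_sep.1 htop).1, subset_antisymm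
    (fun z hz => ZFSet.mem_sUnion_of_mem hz (hT.app_mem _ htop))
    (hsub _ htop)⟩

end IsTowerClosed

theorem IsTransitiveModel.exists_maximal (hM : IsTransitiveModel M) {𝓕 F₀ : ZFSet.{u}}
    (h𝓕 : 𝓕 ∈ M) (hF₀ : F₀ ∈ 𝓕)
    (hchain : ∀ K ∈ M, K ⊆ 𝓕 → IsChainSet K → K ≠ ∅ → (⋃₀ K : ZFSet.{u}) ∈ 𝓕) :
    ∃ G ∈ 𝓕, ∀ G' ∈ 𝓕, G ⊆ G' → G' = G := by
  by_contra! hcon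
  obtain ⟨c, hc, hcf, hcR⟩ := hM.exists_choiceFunction h𝓕 h𝓕
    (ρ := fun x y => x ⊆ y ∧ ¬ y = x) (.and (.subset hM (.var _) (.var _))
      (.not (.eq (.var _) (.var _)))) hcon
  have hclosed : IsTowerClosed M c F₀ 𝓕 :=
    ⟨hF₀, fun x hx => TopInterp.app_mem hcf hx, hchain⟩
  obtain ⟨x, hx, hfix⟩ := hclosed.exists_app_eq_self hM h𝓕 hc
    fun x hx => (hcR x (ZFSet.mem_sep.1 hx).1).1
  exact (hcR x hx).2 hfix

/-! ### Filters of open sets -/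

/-- `F` is a filter in the lattice of open sets of `⟨X, τ⟩`. -/
structure IsOpenFilter (X τ F : ZFSet.{u}) : Prop where
  subset : F ⊆ τ
  univ_mem : X ∈ F
  inter_mem : ∀ O ∈ F, ∀ P ∈ F, O ∩ P ∈ F
  mem_of_subset : ∀ O ∈ F, ∀ P ∈ τ, O ⊆ P → P ∈ F

/-- `F` is a filter of open sets of `⟨X, τ⟩` which is completely prime with respect to the
families of open sets in `M`. These filters are the points of the interpretation of `⟨X, τ⟩`
over `M`. -/
structure IsPrimeFilter (M : Set ZFSet.{u}) (X τ F : ZFSet.{u}) : Prop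
    extends IsOpenFilter X τ F where
  prime : ∀ C ∈ M, C ⊆ τ → (⋃₀ C : ZFSet.{u}) ∈ F → ∃ O ∈ C, O ∈ F

theorem IsSpace.isOpenFilter_sep {X τ B : ZFSet.{u}} (hX : IsSpace M X τ)
    {R : ZFSet.{u} → ZFSet.{u} → Prop} (huniv : ∃ Q ∈ B, R Q X)
    (hinter : ∀ Q ∈ B, ∀ Q' ∈ B, ∀ O ∈ τ, ∀ O' ∈ τ, R Q O → R Q' O' → ∃ Q'' ∈ B, R Q'' (O ∩ O'))
    (hmono : ∀ Q O O', R Q O → O ⊆ O' → R Q O') :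
    IsOpenFilter X τ (ZFSet.sep (fun O => ∃ Q ∈ B, R Q O) τ) where
  subset := ZFSet.sep_subset
  univ_mem := ZFSet.mem_sep.2 ⟨hX.univ_open, huniv⟩
  inter_mem O hO O' hO' := by
    obtain ⟨hO, Q, hQ, h⟩ := ZFSet.mem_sep.1 hO
    obtain ⟨hO', Q', hQ', h'⟩ := ZFSet.mem_sep.1 hO'
    exact ZFSet.mem_sep.2 ⟨hX.inter_open O hO O' hO', hinter Q hQ Q' hQ' O hO O' hO' h h'⟩
  mem_of_subset O hO O' hO' hOO' := by
    obtain ⟨-, Q, hQ, h⟩ := ZFSet.mem_sep.1 hO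
    exact ZFSet.mem_sep.2 ⟨hO', Q, hQ, hmono Q O O' h hOO'⟩

theorem IsSpace.union_mem (hM : IsTransitiveModel M) {X τ : ZFSet.{u}} (hX : IsSpace M X τ)
    {O P : ZFSet.{u}} (hO : O ∈ τ) (hP : P ∈ τ) : O ∪ P ∈ τ := by
  rw [← ZFSet.sUnion_pair]
  refine hX.union_open _ (hM.upair_mem (hM.mem_of_mem hO hX.topology_mem)
    (hM.mem_of_mem hP hX.topology_mem)) fun W hW => ?_
  rcases ZFSet.mem_pair.1 hW with rfl | rfl <;> assumption

/-! ### Compact Hausdorff spaces -/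

/-- The closure of `P` in `⟨Z, ζ⟩` is contained in `O`, as witnessed by an open set `Q` disjoint
from `P` and containing the complement of `O`. -/
def WellInside (Z ζ P O : ZFSet.{u}) : Prop :=
  ∃ Q ∈ ζ, (∀ z ∈ P, z ∉ Q) ∧ ∀ z ∈ Z, z ∈ O ∨ z ∈ Q

section CompactHausdorff

variable {Z ζ P O : ZFSet.{u}}

theorem WellInside.mono {P' O' : ZFSet.{u}} (h : WellInside Z ζ P O) (hP : P' ⊆ P) (hO : O ⊆ O') :
    WellInside Z ζ P' O' := by
  obtain ⟨Q, hQ, hPQ, hOQ⟩ := h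
  exact ⟨Q, hQ, fun z hz => hPQ z (hP hz), fun z hz => (hOQ z hz).imp_left fun h => hO h⟩

theorem WellInside.subset (h : WellInside Z ζ P O) (hP : P ⊆ Z) : P ⊆ O := by
  obtain ⟨Q, -, hPQ, hOQ⟩ := h
  exact fun z hz => (hOQ z (hP hz)).resolve_right (hPQ z hz)

theorem IsSpace.wellInside_univ (hZ : IsSpace M Z ζ) : WellInside Z ζ P Z :=
  ⟨∅, hZ.empty_open, fun z _ => ZFSet.notMem_empty z, fun _ hz => .inl hz⟩

theorem WellInside.inter (hM : IsTransitiveModel M) (hZ : IsSpace M Z ζ) {P' O' : ZFSet.{u}}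
    (h : WellInside Z ζ P O) (h' : WellInside Z ζ P' O') : WellInside Z ζ (P ∩ P') (O ∩ O') := by
  obtain ⟨Q, hQ, hPQ, hOQ⟩ := h
  obtain ⟨Q', hQ', hPQ', hOQ'⟩ := h'
  refine ⟨Q ∪ Q', hZ.union_mem hM hQ hQ', fun z hz => ?_, fun z hz => ?_⟩
  · rw [ZFSet.mem_inter] at hz
    exact fun h => (ZFSet.mem_union.1 h).elim (hPQ z hz.1) (hPQ' z hz.2)
  · have := hOQ z hz
    have := hOQ' z hz
    rw [ZFSet.mem_inter, ZFSet.mem_union]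
    tauto

theorem IsDefinable.wellInside (hM : IsTransitiveModel M) (hZ : Z ∈ M) (hζ : ζ ∈ M)
    {s t : (Fin n → M) → ZFSet.{u}} (hs : IsDefinableMap M s) (ht : IsDefinableMap M t) :
    IsDefinable M fun v => WellInside Z ζ (s v) (t v) :=
  .bex hM (.const hζ) (.and (.ball hM hs.lift (.not (.mem (.var _) (.var _))))
    (.ball hM (.const hZ) (.or (.mem (.var _) ht.lift.lift) (.mem (.var _) (.var _)))))

theorem IsSpace.exists_mem_forall_notMem_of_finite (hZ : IsSpace M Z ζ)
    {𝒱 : Set ZFSet.{u}} (h𝒱 : 𝒱.Finite) {x : ZFSet.{u}} (hx : x ∈ Z)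
    (h : ∀ V ∈ 𝒱, ∃ U ∈ ζ, x ∈ U ∧ ∀ z ∈ U, z ∉ V) :
    ∃ P ∈ ζ, x ∈ P ∧ ∀ V ∈ 𝒱, ∀ z ∈ P, z ∉ V := by
  induction 𝒱, h𝒱 using Set.Finite.induction_on with
  | empty => exact ⟨Z, hZ.univ_open, hx, fun V hV => hV.elim⟩
  | @insert V 𝒱 _ _ ih =>
    obtain ⟨P, hP, hxP, hPV⟩ := ih fun V hV => h V (Set.mem_insert_of_mem _ hV)
    obtain ⟨U, hU, hxU, hUV⟩ := h V (Set.mem_insert _ _)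
    refine ⟨P ∩ U, hZ.inter_open P hP U hU, ZFSet.mem_inter.2 ⟨hxP, hxU⟩, fun W hW z hz => ?_⟩
    rw [ZFSet.mem_inter] at hz
    rcases hW with rfl | hW
    · exact hUV z hz.2
    · exact hPV W hW z hz.1

variable (hM : IsTransitiveModel M) (hZ : IsSpace M Z ζ) (hc : IsCompactSpace M Z ζ)
include hM hZ hc

theorem IsCompactSpace.exists_finite_cover_sdiff {Q C : ZFSet.{u}} (hQ : Q ∈ ζ) (hC : C ∈ M)
    (hCζ : C ⊆ ζ) (hcov : Z \ Q ⊆ (⋃₀ C : ZFSet.{u})) :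
    ∃ D ∈ M, D ⊆ C ∧ (D : Set ZFSet.{u}).Finite ∧ Z \ Q ⊆ (⋃₀ D : ZFSet.{u}) := by
  have hQC : insert Q C ⊆ ζ := fun W hW => by
    rcases ZFSet.mem_insert_iff.1 hW with rfl | hW
    exacts [hQ, hCζ hW]
  obtain ⟨D, hD, hDC, hfin, hDZ⟩ := hc (insert Q C)
    (hM.insert_mem (hM.mem_of_mem hQ hZ.topology_mem) hC) hQC <| by
      ext z
      refine ⟨fun hz => ?_, fun hz => ?_⟩
      · obtain ⟨W, hW, hzW⟩ := ZFSet.mem_sUnion.1 hz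
        exact hZ.subset W (hQC hW) hzW
      · by_cases hzQ : z ∈ Q
        · exact ZFSet.mem_sUnion_of_mem hzQ (ZFSet.mem_insert _ _)
        · obtain ⟨W, hW, hzW⟩ := ZFSet.mem_sUnion.1 (hcov (ZFSet.mem_sdiff.2 ⟨hz, hzQ⟩))
          exact ZFSet.mem_sUnion_of_mem hzW (ZFSet.mem_insert_of_mem _ hW)
  refine ⟨D ∩ C, hM.inter_mem hD hC, fun W hW => (ZFSet.mem_inter.1 hW).2,
    ((hM.isFin_iff_finite hD).1 hfin).subset fun W hW => (ZFSet.mem_inter.1 hW).1, fun z hz => ?_⟩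
  rw [ZFSet.mem_sdiff, ← hDZ] at hz
  obtain ⟨W, hW, hzW⟩ := ZFSet.mem_sUnion.1 hz.1
  refine ZFSet.mem_sUnion_of_mem hzW
    (ZFSet.mem_inter.2 ⟨hW, (ZFSet.mem_insert_iff.1 (hDC hW)).resolve_left ?_⟩)
  rintro rfl
  exact hz.2 hzW

variable (hH : IsHausdorff Z ζ)
include hH

theorem exists_mem_wellInside {x : ZFSet.{u}} (hO : O ∈ ζ) (hx : x ∈ O) :
    ∃ P ∈ ζ, x ∈ P ∧ WellInside Z ζ P O := by
  have hζ := hZ.topology_mem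
  have hOM := hM.mem_of_mem hO hζ
  have hxZ := hZ.subset O hO hx
  obtain ⟨D, hD, hDC, hfin, hcov⟩ := hc.exists_finite_cover_sdiff hM hZ hO
    (C := ZFSet.sep (fun V => ∃ U ∈ ζ, x ∈ U ∧ ∀ z ∈ U, z ∉ V) ζ)
    (hM.sep_mem (.bex hM (.const hζ) (.and (.mem (.const (hM.mem_of_mem hx hOM)) (.var _))
      (.ball hM (.var _) (.not (.mem (.var _) (.var _)))))) hζ) ZFSet.sep_subset fun z hz => by
      rw [ZFSet.mem_sdiff] at hz
      obtain ⟨U, hU, V, hV, hxU, hzV, hUV⟩ := hH x hxZ z hz.1 fun h => hz.2 (h ▸ hx)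
      exact ZFSet.mem_sUnion_of_mem hzV (ZFSet.mem_sep.2 ⟨hV, U, hU, hxU, fun w hw hw' =>
        ZFSet.notMem_empty w (hUV ▸ ZFSet.mem_inter.2 ⟨hw, hw'⟩)⟩)
  obtain ⟨P, hP, hxP, hPD⟩ := hZ.exists_mem_forall_notMem_of_finite hfin hxZ
    fun V hV => (ZFSet.mem_sep.1 (hDC hV)).2
  refine ⟨P, hP, hxP, ⋃₀ D, hZ.union_open D hD fun V hV => (ZFSet.mem_sep.1 (hDC hV)).1,
    fun z hz h => ?_, fun z hz => ?_⟩
  · obtain ⟨V, hV, hzV⟩ := ZFSet.mem_sUnion.1 h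
    exact hPD V hV z hz hzV
  · exact or_iff_not_imp_left.2 fun hzO => hcov (ZFSet.mem_sdiff.2 ⟨hz, hzO⟩)

theorem sUnion_wellInside (hO : O ∈ ζ) :
    (⋃₀ (ZFSet.sep (fun P => WellInside Z ζ P O) ζ) : ZFSet.{u}) = O := by
  ext z
  refine ⟨fun h => ?_, fun hz => ?_⟩
  · obtain ⟨P, hP, hz⟩ := ZFSet.mem_sUnion.1 h
    obtain ⟨hP, hPO⟩ := ZFSet.mem_sep.1 hP
    exact hPO.subset (hZ.subset P hP) hz
  · obtain ⟨P, hP, hzP, hPO⟩ := exists_mem_wellInside hM hZ hc hH hO hz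
    exact ZFSet.mem_sUnion_of_mem hzP (ZFSet.mem_sep.2 ⟨hP, hPO⟩)

theorem IsPrimeFilter.exists_wellInside {F : ZFSet.{u}} (hF : IsPrimeFilter M Z ζ F)
    (hO : O ∈ F) : ∃ P ∈ F, WellInside Z ζ P O := by
  have hOζ := hF.subset hO
  obtain ⟨P, hP, hPF⟩ := hF.prime (ZFSet.sep (fun P => WellInside Z ζ P O) ζ)
    (hM.sep_mem (.wellInside hM hZ.carrier_mem hZ.topology_mem (.var _)
      (.const (hM.mem_of_mem hOζ hZ.topology_mem))) hZ.topology_mem)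
    ZFSet.sep_subset ((sUnion_wellInside hM hZ hc hH hOζ).symm ▸ hO)
  exact ⟨P, hPF, (ZFSet.mem_sep.1 hP).2⟩

end CompactHausdorff

/-! ### Shrinking sequences of open sets -/

/-- `s` is a sequence of open sets of `⟨Z, ζ⟩` outside `I` such that the closure of `s (k + 1)` is
contained in `s k ∩ g(k)`. In a compact space, `⋂ₖ s k` is then a compact subset of the `G_δ` set
`⋂ₖ g(k)`. -/
structure IsShrinking (Z ζ g I : ZFSet.{u}) (s : ℕ → ZFSet.{u}) : Prop where
  mem : ∀ k, s k ∈ ζ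
  notMem : ∀ k, s k ∉ I
  wellInside : ∀ k, WellInside Z ζ (s (k + 1)) (s k ∩ app g (nat k))

section Shrinking

variable {Z ζ g I : ZFSet.{u}} {s : ℕ → ZFSet.{u}}

theorem IsShrinking.antitone (hs : IsShrinking Z ζ g I s) (hZ : IsSpace M Z ζ) {i j : ℕ}
    (hij : i ≤ j) : s j ⊆ s i := by
  induction j, hij using Nat.le_induction with
  | base => exact fun _ h => h
  | succ j _ ih =>
    intro z hz
    exact ih (ZFSet.mem_inter.1 ((hs.wellInside j).subset (hZ.subset _ (hs.mem _)) hz)).1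

theorem IsShrinking.exists_of_forall_exists {G Q : ZFSet.{u}} (hGζ : G ⊆ ζ) (hGI : ∀ P ∈ G, P ∉ I)
    (hQ : Q ∈ G)
    (hG : ∀ k, ∀ P ∈ G, ∃ P' ∈ G, WellInside Z ζ P' (P ∩ app g (nat k))) :
    ∃ s, IsShrinking Z ζ g I s ∧ s 0 = Q := by
  choose! next hnextG hnext using hG
  let s : ℕ → ZFSet.{u} := fun k => Nat.rec Q next k
  have hsG (k : ℕ) : s k ∈ G := by
    induction k with
    | zero => exact hQ
    | succ k ih => exact hnextG k (s k) ih
  exact ⟨s, ⟨fun k => hGζ (hsG k), fun k => hGI _ (hsG k), fun k => hnext k (s k) (hsG k)⟩, rfl⟩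

theorem IsShrinking.exists_range_mem (hs : IsShrinking Z ζ g I s) (hM : IsTransitiveModel M)
    (hZ : Z ∈ M) (hζ : ζ ∈ M) (hg : g ∈ M) (hI : I ∈ M) :
    ∃ t, IsShrinking Z ζ g I t ∧ t 0 = s 0 ∧ ∃ b ∈ M, ∀ x, x ∈ b ↔ ∃ k, x = t k := by
  obtain ⟨t, ht₀, htS, ht, hb⟩ := hM.exists_path (hM.sdiff_mem hζ hI)
    (ρ := fun k P P' => WellInside Z ζ P' (P ∩ app g k))
    (.wellInside hM hZ hζ (.var _) (.inter hM (.var _) (.app hM (.const hg) (.var _))))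
    (s := s) (fun k => ZFSet.mem_sdiff.2 ⟨hs.mem k, hs.notMem k⟩) hs.wellInside
  exact ⟨t, ⟨fun k => (ZFSet.mem_sdiff.1 (htS k)).1, fun k => (ZFSet.mem_sdiff.1 (htS k)).2, ht⟩,
    ht₀, hb⟩

theorem IsShrinking.isOpenFilter {b : ZFSet.{u}} (hs : IsShrinking Z ζ g I s) (hZ : IsSpace M Z ζ)
    (hb : ∀ x, x ∈ b ↔ ∃ k, x = s k) :
    IsOpenFilter Z ζ (ZFSet.sep (fun O => ∃ P ∈ b, P ⊆ O) ζ) := by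
  refine hZ.isOpenFilter_sep (R := fun P O => P ⊆ O)
    ⟨s 0, (hb _).2 ⟨0, rfl⟩, hZ.subset _ (hs.mem 0)⟩ ?_ fun _ _ _ h h' z hz => h' (h hz)
  intro P hP P' hP' O _ O' _ h h'
  obtain ⟨i, rfl⟩ := (hb P).1 hP
  obtain ⟨j, rfl⟩ := (hb P').1 hP'
  exact ⟨s (max i j), (hb _).2 ⟨_, rfl⟩, fun z hz => ZFSet.mem_inter.2
    ⟨h (hs.antitone hZ (le_max_left i j) hz), h' (hs.antitone hZ (le_max_right i j) hz)⟩⟩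

variable (hM : IsTransitiveModel M) (hZ : IsSpace M Z ζ) (hc : IsCompactSpace M Z ζ)
include hM hZ hc

theorem IsShrinking.exists_forall_mem {b W : ZFSet.{u}} (hs : IsShrinking Z ζ g I s)
    (hb : b ∈ M) (hbs : ∀ x, x ∈ b ↔ ∃ k, x = s k) (hW : W ∈ ζ) (hsW : ∀ k, ¬ s k ⊆ W) :
    ∃ z ∈ Z, z ∉ W ∧ ∀ k, z ∈ s k ∩ app g (nat k) := by
  let C := ZFSet.sep (fun V => ∃ P ∈ b, ∀ z ∈ P, z ∉ V) ζ
  have hC : C ∈ M := hM.sep_mem (.bex hM (.const hb) (.ball hM (.var _)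
    (.not (.mem (.var _) (.var _))))) hZ.topology_mem
  obtain ⟨z, hz, hzC⟩ : ∃ z ∈ Z \ W, z ∉ (⋃₀ C : ZFSet.{u}) := by
    by_contra! hcov
    obtain ⟨D, -, hDC, hfin, hD⟩ := hc.exists_finite_cover_sdiff hM hZ hW hC ZFSet.sep_subset hcov
    have hdisj (V : ZFSet.{u}) (hV : V ∈ D) : ∃ k, ∀ z ∈ s k, z ∉ V := by
      obtain ⟨-, P, hP, h⟩ := ZFSet.mem_sep.1 (hDC hV)
      obtain ⟨k, rfl⟩ := (hbs P).1 hP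
      exact ⟨k, h⟩
    choose! j hj using hdisj
    obtain ⟨k, hk⟩ := (hfin.image j).bddAbove
    refine hsW k fun z hz => by_contra fun hzW => ?_
    obtain ⟨V, hV, hzV⟩ := ZFSet.mem_sUnion.1
      (hD (ZFSet.mem_sdiff.2 ⟨hZ.subset _ (hs.mem k) hz, hzW⟩))
    exact hj V hV z (hs.antitone hZ (hk ⟨V, hV, rfl⟩) hz) hzV
  obtain ⟨hz, hzW⟩ := ZFSet.mem_sdiff.1 hz
  refine ⟨z, hz, hzW, fun k => ?_⟩
  obtain ⟨V, hV, hsV, hV'⟩ := hs.wellInside k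
  exact (hV' z hz).resolve_right fun hzV => hzC
    (ZFSet.mem_sUnion_of_mem hzV (ZFSet.mem_sep.2 ⟨hV, _, (hbs _).2 ⟨k + 1, rfl⟩, hsV⟩))

theorem IsPrimeFilter.mem_of_inter_subset (hH : IsHausdorff Z ζ) (hg : g ∈ M) {G Q W : ZFSet.{u}}
    (hG : IsPrimeFilter M Z ζ G) (hgG : ∀ k, app g (nat k) ∈ G) (hQ : Q ∈ G) (hW : W ∈ ζ)
    (hQW : ∀ z ∈ Q, (∀ k, z ∈ app g (nat k)) → z ∈ W) : W ∈ G := by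
  by_contra hWG
  have hζ := hZ.topology_mem
  obtain ⟨s, hs, hs₀⟩ := IsShrinking.exists_of_forall_exists (Z := Z) (g := g)
    (I := ZFSet.sep (fun P => P ⊆ W) ζ) hG.subset
    (fun P hP h => hWG (hG.mem_of_subset P hP W hW (ZFSet.mem_sep.1 h).2)) hQ
    fun k P hP => hG.exists_wellInside hM hZ hc hH (hG.inter_mem P hP _ (hgG k))
  obtain ⟨t, ht, ht₀, b, hb, hbt⟩ := hs.exists_range_mem hM hZ.carrier_mem hζ hg
    (hM.sep_mem (.subset hM (.var _) (.const (hM.mem_of_mem hW hζ))) hζ)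
  obtain ⟨z, -, hzW, hz⟩ := ht.exists_forall_mem hM hZ hc hb hbt hW
    fun k h => ht.notMem k (ZFSet.mem_sep.2 ⟨ht.mem k, h⟩)
  refine hzW (hQW z ?_ fun k => (ZFSet.mem_inter.1 (hz k)).2)
  rw [← hs₀, ← ht₀]
  exact (ZFSet.mem_inter.1 (hz 0)).1

end Shrinking

/-! ### Prime filters avoiding an ideal -/

/-- `I` contains `∅`, and is closed downwards among the open sets in `ζ` and under binary unions. -/
structure IsOpenIdeal (ζ I : ZFSet.{u}) : Prop where
  empty_mem : ∅ ∈ I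
  mem_of_subset : ∀ O ∈ I, ∀ P ∈ ζ, P ⊆ O → P ∈ I
  union_mem : ∀ O ∈ I, ∀ P ∈ I, O ∪ P ∈ I

section Ideal

variable {Z ζ G I : ZFSet.{u}}

theorem IsOpenFilter.sUnion {K : ZFSet.{u}} (hK : ∀ G ∈ K, IsOpenFilter Z ζ G)
    (hchain : IsChainSet K) (hne : K.Nonempty) : IsOpenFilter Z ζ (⋃₀ K) where
  subset O hO := by
    obtain ⟨G, hG, hO⟩ := ZFSet.mem_sUnion.1 hO
    exact (hK G hG).subset hO
  univ_mem := hne.elim fun G hG => ZFSet.mem_sUnion_of_mem (hK G hG).univ_mem hG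
  inter_mem O hO P hP := by
    obtain ⟨G, hG, hO⟩ := ZFSet.mem_sUnion.1 hO
    obtain ⟨G', hG', hP⟩ := ZFSet.mem_sUnion.1 hP
    rcases hchain G hG G' hG' with h | h
    · exact ZFSet.mem_sUnion_of_mem ((hK G' hG').inter_mem O (h hO) P hP) hG'
    · exact ZFSet.mem_sUnion_of_mem ((hK G hG).inter_mem O hO P (h hP)) hG
  mem_of_subset O hO P hP hOP := by
    obtain ⟨G, hG, hO⟩ := ZFSet.mem_sUnion.1 hO
    exact ZFSet.mem_sUnion_of_mem ((hK G hG).mem_of_subset O hO P hP hOP) hG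

theorem IsTransitiveModel.exists_maximal_isOpenFilter (hM : IsTransitiveModel M) (hζ : ζ ∈ M)
    (hI : I ∈ M) {F : ZFSet.{u}} (hFM : F ∈ M) (hF : IsOpenFilter Z ζ F) (hFI : ∀ O ∈ F, O ∉ I) :
    ∃ G ∈ M, F ⊆ G ∧ IsOpenFilter Z ζ G ∧ (∀ O ∈ G, O ∉ I) ∧
      ∀ G' ∈ M, IsOpenFilter Z ζ G' → (∀ O ∈ G', O ∉ I) → G ⊆ G' → G' = G := by
  let φ (G : ZFSet.{u}) : Prop := F ⊆ G ∧ (∀ O ∈ G, ∀ P ∈ G, O ∩ P ∈ G) ∧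
    (∀ O ∈ G, ∀ P ∈ ζ, O ⊆ P → P ∈ G) ∧ ∀ O ∈ G, O ∉ I
  have hφ : IsDefinable M fun v : Fin 1 → M => φ (v 0) :=
    .and (.subset hM (.const hFM) (.var _)) (.and (.ball hM (.var _) (.ball hM (.var _)
      (.mem (.inter hM (.var _) (.var _)) (.var _)))) (.and (.ball hM (.var _)
      (.ball hM (.const hζ) (.imp (.subset hM (.var _) (.var _)) (.mem (.var _) (.var _)))))
      (.ball hM (.var _) (.not (.mem (.var _) (.const hI))))))
  let 𝓕 := ZFSet.sep (fun G => G ∈ M ∧ φ G) ζ.powerset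
  have mem_𝓕 (G : ZFSet.{u}) : G ∈ 𝓕 ↔
      (G ∈ M ∧ F ⊆ G) ∧ IsOpenFilter Z ζ G ∧ ∀ O ∈ G, O ∉ I := by
    rw [ZFSet.mem_sep, ZFSet.mem_powerset]
    exact ⟨fun ⟨h, hG, hFG, hinter, hup, hGI⟩ =>
      ⟨⟨hG, hFG⟩, ⟨h, hFG hF.univ_mem, hinter, hup⟩, hGI⟩,
      fun ⟨⟨hG, hFG⟩, h, hGI⟩ => ⟨h.subset, hG, hFG, h.inter_mem, h.mem_of_subset, hGI⟩⟩
  have hchain : ∀ K ∈ M, K ⊆ 𝓕 → IsChainSet K → K ≠ ∅ → (⋃₀ K : ZFSet.{u}) ∈ 𝓕 := by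
    intro K hK hK𝓕 hchain hne
    obtain ⟨G₀, hG₀⟩ := (ZFSet.eq_empty_or_nonempty K).resolve_left hne
    refine (mem_𝓕 _).2 ⟨⟨hM.sUnion_mem hK, fun O hO =>
      ZFSet.mem_sUnion_of_mem (((mem_𝓕 G₀).1 (hK𝓕 hG₀)).1.2 hO) hG₀⟩,
      .sUnion (fun G hG => ((mem_𝓕 G).1 (hK𝓕 hG)).2.1) hchain ⟨G₀, hG₀⟩, fun O hO => ?_⟩
    obtain ⟨G, hG, hO⟩ := ZFSet.mem_sUnion.1 hO
    exact ((mem_𝓕 G).1 (hK𝓕 hG)).2.2 O hO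
  obtain ⟨G, hG, hmax⟩ := hM.exists_maximal (hM.sep_powerset_sep_mem hφ hζ)
    ((mem_𝓕 F).2 ⟨⟨hFM, fun _ h => h⟩, hF, hFI⟩) hchain
  obtain ⟨⟨hGM, hFG⟩, hGf, hGI⟩ := (mem_𝓕 G).1 hG
  exact ⟨G, hGM, hFG, hGf, hGI, fun G' hG'M hG' hG'I h =>
    hmax G' ((mem_𝓕 G').2 ⟨⟨hG'M, fun _ hz => h (hFG hz)⟩, hG', hG'I⟩) h⟩

theorem IsOpenFilter.exists_inter_mem_of_maximal (hG : IsOpenFilter Z ζ G)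
    (hM : IsTransitiveModel M) (hGM : G ∈ M) {N : Set ZFSet.{u}} (hZ : IsSpace N Z ζ) (hζ : ζ ∈ M)
    (hI : IsOpenIdeal ζ I)
    (hmax : ∀ G' ∈ M, IsOpenFilter Z ζ G' → (∀ O ∈ G', O ∉ I) → G ⊆ G' → G' = G)
    {O : ZFSet.{u}} (hO : O ∈ ζ) (hOG : O ∉ G) : ∃ Q ∈ G, Q ∩ O ∈ I := by
  by_contra! hGO
  have hOM := hM.mem_of_mem hO hζ
  let G' := ZFSet.sep (fun W => ∃ Q ∈ G, Q ∩ O ⊆ W) ζ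
  have hG'M : G' ∈ M := hM.sep_mem (.bex hM (.const hGM)
    (.subset hM (.inter hM (.var _) (.const hOM)) (.var _))) hζ
  have hG' : IsOpenFilter Z ζ G' := by
    refine hZ.isOpenFilter_sep (R := fun Q W => Q ∩ O ⊆ W)
      ⟨Z, hG.univ_mem, fun z hz => (ZFSet.mem_inter.1 hz).1⟩ ?_
      fun _ _ _ h h' z hz => h' (h hz)
    refine fun Q hQ Q' hQ' W _ W' _ h h' => ⟨Q ∩ Q', hG.inter_mem Q hQ Q' hQ', fun z hz => ?_⟩
    simp only [ZFSet.mem_inter] at hz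
    exact ZFSet.mem_inter.2
      ⟨h (ZFSet.mem_inter.2 ⟨hz.1.1, hz.2⟩), h' (ZFSet.mem_inter.2 ⟨hz.1.2, hz.2⟩)⟩
  have hG'I : ∀ W ∈ G', W ∉ I := by
    intro W hW hWI
    obtain ⟨-, Q, hQ, h⟩ := ZFSet.mem_sep.1 hW
    exact hGO Q hQ (hI.mem_of_subset W hWI _ (hZ.inter_open Q (hG.subset hQ) O hO) h)
  have hGG' : G ⊆ G' := fun Q hQ =>
    ZFSet.mem_sep.2 ⟨hG.subset hQ, Q, hQ, fun z hz => (ZFSet.mem_inter.1 hz).1⟩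
  rw [← hmax G' hG'M hG' hG'I hGG'] at hOG
  exact hOG (ZFSet.mem_sep.2 ⟨hO, Z, hG.univ_mem, fun z hz => (ZFSet.mem_inter.1 hz).2⟩)

theorem IsOpenFilter.exists_inter_subset_of_finite (hG : IsOpenFilter Z ζ G) (hI : IsOpenIdeal ζ I)
    {𝒲 : Set ZFSet.{u}} (h𝒲 : 𝒲.Finite) (h : ∀ W ∈ 𝒲, ∃ Q ∈ G, Q ∩ W ∈ I) :
    ∃ Q ∈ G, ∃ J ∈ I, ∀ W ∈ 𝒲, Q ∩ W ⊆ J := by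
  induction 𝒲, h𝒲 using Set.Finite.induction_on with
  | empty => exact ⟨Z, hG.univ_mem, ∅, hI.empty_mem, fun W hW => hW.elim⟩
  | @insert V 𝒲 _ _ ih =>
    obtain ⟨Q, hQ, J, hJ, hQJ⟩ := ih fun W hW => h W (Set.mem_insert_of_mem _ hW)
    obtain ⟨Q', hQ', hQV⟩ := h V (Set.mem_insert _ _)
    refine ⟨Q ∩ Q', hG.inter_mem Q hQ Q' hQ', J ∪ Q' ∩ V, hI.union_mem J hJ _ hQV,
      fun W hW z hz => ?_⟩
    simp only [ZFSet.mem_inter] at hz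
    rw [ZFSet.mem_union, ZFSet.mem_inter]
    rcases hW with rfl | hW
    · exact .inr ⟨hz.1.2, hz.2⟩
    · exact .inl (hQJ W hW (ZFSet.mem_inter.2 ⟨hz.1.1, hz.2⟩))

theorem IsOpenFilter.exists_mem_of_subset_sUnion (hG : IsOpenFilter Z ζ G) (hI : IsOpenIdeal ζ I)
    (hGI : ∀ O ∈ G, O ∉ I) (h : ∀ O ∈ ζ, O ∉ G → ∃ Q ∈ G, Q ∩ O ∈ I) {D P : ZFSet.{u}}
    (hD : (D : Set ZFSet.{u}).Finite) (hDζ : D ⊆ ζ) (hP : P ∈ G)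
    (hPD : P ⊆ (⋃₀ D : ZFSet.{u})) : ∃ W ∈ D, W ∈ G := by
  by_contra! hDG
  obtain ⟨Q, hQ, J, hJ, hQJ⟩ := hG.exists_inter_subset_of_finite hI hD
    fun W hW => h W (hDζ hW) (hDG W hW)
  have hPQ := hG.inter_mem P hP Q hQ
  refine hGI _ hPQ (hI.mem_of_subset J hJ _ (hG.subset hPQ) fun z hz => ?_)
  rw [ZFSet.mem_inter] at hz
  obtain ⟨W, hW, hzW⟩ := ZFSet.mem_sUnion.1 (hPD hz.1)
  exact hQJ W hW (ZFSet.mem_inter.2 ⟨hz.2, hzW⟩)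

theorem IsOpenFilter.isPrimeFilter_wellInside (hG : IsOpenFilter Z ζ G) (hM : IsTransitiveModel M)
    (hZ : IsSpace M Z ζ) (hc : IsCompactSpace M Z ζ) (hH : IsHausdorff Z ζ)
    (hprime : ∀ D ⊆ ζ, (D : Set ZFSet.{u}).Finite → ∀ P ∈ G, P ⊆ (⋃₀ D : ZFSet.{u}) →
      ∃ W ∈ D, W ∈ G) :
    IsPrimeFilter M Z ζ (ZFSet.sep (fun O => ∃ P ∈ G, WellInside Z ζ P O) ζ) where
  toIsOpenFilter := hZ.isOpenFilter_sep ⟨Z, hG.univ_mem, hZ.wellInside_univ⟩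
    (fun Q hQ Q' hQ' _ _ _ _ h h' => ⟨Q ∩ Q', hG.inter_mem Q hQ Q' hQ', h.inter hM hZ h'⟩)
    fun _ _ _ h => h.mono fun _ hz => hz
  prime C hC hCζ hCG := by
    obtain ⟨-, P, hP, Q, hQ, hPQ, hCQ⟩ := ZFSet.mem_sep.1 hCG
    have hζ := hZ.topology_mem
    obtain ⟨D, -, hDC, hfin, hD⟩ := hc.exists_finite_cover_sdiff hM hZ hQ
      (C := ZFSet.sep (fun W => ∃ O ∈ C, WellInside Z ζ W O) ζ)
      (hM.sep_mem (.bex hM (.const hC) (.wellInside hM hZ.carrier_mem hζ (.var _) (.var _))) hζ)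
      ZFSet.sep_subset fun z hz => by
        rw [ZFSet.mem_sdiff] at hz
        obtain ⟨O, hO, hzO⟩ := ZFSet.mem_sUnion.1 ((hCQ z hz.1).resolve_right hz.2)
        obtain ⟨W, hW, hzW, hWO⟩ := exists_mem_wellInside hM hZ hc hH (hCζ hO) hzO
        exact ZFSet.mem_sUnion_of_mem hzW (ZFSet.mem_sep.2 ⟨hW, O, hO, hWO⟩)
    obtain ⟨W, hW, hWG⟩ := hprime D (fun W hW => (ZFSet.mem_sep.1 (hDC hW)).1) hfin P hP
      fun z hz => hD (ZFSet.mem_sdiff.2 ⟨hZ.subset P (hG.subset hP) hz, hPQ z hz⟩)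
    obtain ⟨-, O, hO, hWO⟩ := ZFSet.mem_sep.1 (hDC hW)
    exact ⟨O, hO, ZFSet.mem_sep.2 ⟨hCζ hO, W, hWG, hWO⟩⟩

theorem IsShrinking.exists_isPrimeFilter {N : Set ZFSet.{u}} {g b : ZFSet.{u}} {s : ℕ → ZFSet.{u}}
    (hs : IsShrinking Z ζ g I s) (hM : IsTransitiveModel M) (hZ : IsSpace M Z ζ)
    (hc : IsCompactSpace M Z ζ) (hH : IsHausdorff Z ζ) (hN : IsTransitiveModel N) (hMN : M ⊆ N)
    (hb : b ∈ N) (hbs : ∀ x, x ∈ b ↔ ∃ k, x = s k) (hIN : I ∈ N) (hI : IsOpenIdeal ζ I) :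
    ∃ G ∈ N, IsPrimeFilter M Z ζ G ∧ (∀ O ∈ G, O ∉ I) ∧
      ∀ O ∈ ζ, ∀ k, WellInside Z ζ (s k) O → O ∈ G := by
  have hζ := hMN hZ.topology_mem
  obtain ⟨G, hGN, hFG, hG, hGI, hmax⟩ := hN.exists_maximal_isOpenFilter hζ hIN
    (hN.sep_mem (.bex hN (.const hb) (.subset hN (.var _) (.var _))) hζ) (hs.isOpenFilter hZ hbs)
    fun O hO hOI => by
      obtain ⟨-, P, hP, hPO⟩ := ZFSet.mem_sep.1 hO
      obtain ⟨k, rfl⟩ := (hbs P).1 hP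
      exact hs.notMem k (hI.mem_of_subset O hOI _ (hs.mem k) hPO)
  have hsG (k : ℕ) : s k ∈ G :=
    hFG (ZFSet.mem_sep.2 ⟨hs.mem k, s k, (hbs _).2 ⟨k, rfl⟩, fun _ hz => hz⟩)
  have hGO : ∀ O ∈ ζ, O ∉ G → ∃ Q ∈ G, Q ∩ O ∈ I := fun O hO =>
    hG.exists_inter_mem_of_maximal hN hGN hZ hζ hI hmax hO
  refine ⟨ZFSet.sep (fun O => ∃ P ∈ G, WellInside Z ζ P O) ζ, hN.sep_mem (.bex hN (.const hGN)
    (.wellInside hN (hMN hZ.carrier_mem) hζ (.var _) (.var _))) hζ,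
    hG.isPrimeFilter_wellInside hM hZ hc hH fun D hDζ hD P hP hPD =>
      hG.exists_mem_of_subset_sUnion hI hGI hGO hD hDζ hP hPD, fun O hO hOI => ?_,
    fun O hO k h => ZFSet.mem_sep.2 ⟨hO, s k, hsG k, h⟩⟩
  obtain ⟨-, P, hP, hPO⟩ := ZFSet.mem_sep.1 hO
  have hPζ := hG.subset hP
  exact hGI P hP (hI.mem_of_subset O hOI P hPζ (hPO.subset (hZ.subset P hPζ)))

end Ideal

/-! ### Open images of Čech complete spaces -/

/-- The image of `U` under the function `f` into `X`. -/
noncomputable def image (X f U : ZFSet.{u}) : ZFSet.{u} :=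
  ZFSet.sep (fun x => ∃ y ∈ U, app f y = x) X

section Image

variable {X Y f P U V : ZFSet.{u}}

theorem image_mono (h : U ⊆ V) : image X f U ⊆ image X f V := fun x hx => by
  obtain ⟨hx, y, hy, hyx⟩ := ZFSet.mem_sep.1 hx
  exact ZFSet.mem_sep.2 ⟨hx, y, h hy, hyx⟩

theorem image_subset_iff (hf : ZFSet.IsFunc Y X f) (hU : U ⊆ Y) :
    image X f U ⊆ P ↔ ∀ y ∈ U, app f y ∈ P := by
  refine ⟨fun h y hy => h (ZFSet.mem_sep.2 ⟨app_mem hf (hU hy), y, hy, rfl⟩), fun h x hx => ?_⟩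
  obtain ⟨-, y, hy, rfl⟩ := ZFSet.mem_sep.1 hx
  exact h y hy

theorem IsDefinableMap.image (hM : IsTransitiveModel M) (hX : X ∈ M) (hf : f ∈ M)
    {t : (Fin n → M) → ZFSet.{u}} (ht : IsDefinableMap M t) :
    IsDefinableMap M fun v => TopInterp.image X f (t v) :=
  .sep hM (φ := fun v x => ∃ y ∈ t v, TopInterp.app f y = x)
    (.bex hM ht.lift (.eq (.app hM (.const hf) (.var _)) (.var _))) (.const hX)

end Image

/-- `f` exhibits `⟨X, τ⟩` as a continuous open image of the `G_δ` subspace `Y = ⋂ₖ g(k)` of the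
compact Hausdorff space `⟨Z, ζ⟩`. The topology of `Y` is not named: its members are the traces
`Q ∩ Y` with `Q ∈ ζ`. -/
structure IsCechPresentation (M : Set ZFSet.{u}) (Z ζ g Y X τ f : ZFSet.{u}) : Prop where
  isSpace : IsSpace M Z ζ
  isHausdorff : IsHausdorff Z ζ
  isCompactSpace : IsCompactSpace M Z ζ
  sequence_mem : g ∈ M
  app_mem : ∀ k, app g (nat k) ∈ ζ
  carrier_mem : Y ∈ M
  mem_iff : ∀ z, z ∈ Y ↔ z ∈ Z ∧ ∀ k, z ∈ app g (nat k)
  map_mem : f ∈ M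
  isFunc : ZFSet.IsFunc Y X f
  image_mem : ∀ Q ∈ ζ, image X f (Q ∩ Y) ∈ τ
  exists_preimage : ∀ P ∈ τ, ∃ Q ∈ ζ, (∀ y ∈ Y, y ∈ Q ↔ app f y ∈ P) ∧ image X f (Q ∩ Y) = P

theorem IsCechComplete.exists_isCechPresentation {X τ Y υ f : ZFSet.{u}} (hX : IsSpace M X τ)
    (hY : IsCechComplete M Y υ) (hf : f ∈ M) (hfs : IsOpenContinuousSurjection Y υ X τ f) :
    ∃ Z ζ g, IsCechPresentation M Z ζ g Y X τ f := by
  obtain ⟨hYs, Z, ζ, hZ, hH, hc, ⟨g, hg, hgf, hYg⟩, hυ⟩ := hY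
  refine ⟨Z, ζ, g, hZ, hH, hc, hg, fun k => app_mem hgf (nat_mem_omega k), hYs.carrier_mem,
    fun z => ?_, hf, hfs.isFunc, fun Q hQ => hfs.isOpen _ ((hυ _).2 ⟨Q, hQ, rfl⟩),
    fun P hP => ?_⟩
  · simp only [hYg, mem_omega_iff, forall_exists_index, forall_eq_apply_imp_iff]
  · obtain ⟨Q, hQ, h⟩ := (hυ _).1 (hfs.continuous P hP)
    have hQP : ∀ y ∈ Y, y ∈ Q ↔ app f y ∈ P := fun y hy => by
      simpa only [ZFSet.mem_sep, ZFSet.mem_inter, hy, true_and, and_true] using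
        (ZFSet.ext_iff.1 h y).symm
    refine ⟨Q, hQ, hQP, ZFSet.ext fun x => ?_⟩
    rw [← h, image, ZFSet.mem_sep]
    constructor
    · rintro ⟨-, y, hy, rfl⟩
      exact (ZFSet.mem_sep.1 hy).2
    · intro hx
      obtain ⟨y, hy, rfl⟩ := hfs.surjective x (hX.subset P hP hx)
      exact ⟨app_mem hfs.isFunc hy, y, ZFSet.mem_sep.2 ⟨hy, hx⟩, rfl⟩

/-- The open sets `Q` of `⟨Z, ζ⟩` such that finitely many members of `C` cover the image of
`Q ∩ Y`. -/
noncomputable def coverIdeal (ζ Y X f C : ZFSet.{u}) : ZFSet.{u} :=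
  ZFSet.sep (fun Q => ∃ D : ZFSet.{u}, (D : Set ZFSet.{u}).Finite ∧ D ⊆ C ∧
    image X f (Q ∩ Y) ⊆ (⋃₀ D : ZFSet.{u})) ζ

theorem IsPrimeFilter.notMem_coverIdeal {ζ Y X τ f C F : ZFSet.{u}} (hF : IsPrimeFilter M X τ F)
    (hM : IsTransitiveModel M) (hX : IsSpace M X τ) (hCτ : C ⊆ τ) (hFC : ∀ P ∈ C, P ∉ F)
    {Q : ZFSet.{u}} (hQ : image X f (Q ∩ Y) ∈ F) : Q ∉ coverIdeal ζ Y X f C := by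
  intro hQC
  obtain ⟨-, D, hD, hDC, h⟩ := ZFSet.mem_sep.1 hQC
  obtain ⟨D', hD', hDD'⟩ := hM.exists_coe_eq_of_finite hD fun P hP =>
    hM.mem_of_mem (hCτ (hDC hP)) hX.topology_mem
  obtain rfl := SetLike.coe_injective hDD'
  have hDτ : D' ⊆ τ := fun P hP => hCτ (hDC hP)
  obtain ⟨P, hPD, hPF⟩ := hF.prime D' hD' hDτ (hF.mem_of_subset _ hQ _ (hX.union_open D' hD' hDτ) h)
  exact hFC P (hDC hPD) hPF

namespace IsCechPresentation

variable {Z ζ g Y X τ f C F G : ZFSet.{u}} (hP : IsCechPresentation M Z ζ g Y X τ f)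
include hP

theorem coverIdeal_mem {N : Set ZFSet.{u}} (hN : IsTransitiveModel N) (hMN : M ⊆ N)
    (hX : X ∈ N) (hC : C ∈ N) : coverIdeal ζ Y X f C ∈ N := by
  have hζ := hMN hP.isSpace.topology_mem
  convert hN.sep_mem (φ := fun Q => ∃ D ∈ N, (D : Set ZFSet.{u}).Finite ∧ D ⊆ C ∧
    image X f (Q ∩ Y) ⊆ (⋃₀ D : ZFSet.{u})) (.ex (.and (hN.definable_finite.subst₁
      (ρ := fun D => (D : Set ZFSet.{u}).Finite) (.var _))
      (.and (.subset hN (.var _) (.const hC)) (.subset hN (.image hN hX (hMN hP.map_mem)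
        (.inter hN (.var _) (.const (hMN hP.carrier_mem)))) (.sUnion hN (.var _)))))) hζ using 1
  ext Q
  rw [coverIdeal, ZFSet.mem_sep, ZFSet.mem_sep]
  refine and_congr_right fun _ => exists_congr fun D => (and_iff_right_of_imp fun h => ?_).symm
  obtain ⟨D', hD', hDD'⟩ := hN.exists_coe_eq_of_finite h.1 fun P hPD => hN.mem_of_mem (h.2.1 hPD) hC
  rwa [← SetLike.coe_injective hDD']

theorem isOpenIdeal_coverIdeal (hM : IsTransitiveModel M) :
    IsOpenIdeal ζ (coverIdeal ζ Y X f C) where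
  empty_mem := ZFSet.mem_sep.2 ⟨hP.isSpace.empty_open, ∅, by simp, by simp, by
    rw [image_subset_iff hP.isFunc fun y hy => (ZFSet.mem_inter.1 hy).2]
    exact fun y hy => absurd (ZFSet.mem_inter.1 hy).1 (ZFSet.notMem_empty y)⟩
  mem_of_subset O hO Q hQ hQO := by
    obtain ⟨-, D, hD, hDC, h⟩ := ZFSet.mem_sep.1 hO
    refine ZFSet.mem_sep.2 ⟨hQ, D, hD, hDC, fun x hx => h (image_mono (fun y hy => ?_) hx)⟩
    rw [ZFSet.mem_inter] at hy ⊢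
    exact ⟨hQO hy.1, hy.2⟩
  union_mem O hO Q hQ := by
    obtain ⟨hOζ, D, hD, hDC, h⟩ := ZFSet.mem_sep.1 hO
    obtain ⟨hQζ, D', hD', hDC', h'⟩ := ZFSet.mem_sep.1 hQ
    have hsub (R : ZFSet.{u}) : R ∩ Y ⊆ Y := fun y hy => (ZFSet.mem_inter.1 hy).2
    rw [image_subset_iff hP.isFunc (hsub _)] at h h'
    refine ZFSet.mem_sep.2 ⟨hP.isSpace.union_mem hM hOζ hQζ, D ∪ D', ?_, fun P hPD =>
      (ZFSet.mem_union.1 hPD).elim (hDC ·) (hDC' ·), ?_⟩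
    · rw [ZFSet.coe_union]
      exact hD.union hD'
    · rw [image_subset_iff hP.isFunc (hsub _)]
      simp only [ZFSet.mem_inter, ZFSet.mem_union, ZFSet.mem_sUnion, or_and_right,
        exists_or] at h h' ⊢
      exact fun y => Or.imp (h y) (h' y)

section Model

variable (hM : IsTransitiveModel M) (hX : IsSpace M X τ)
include hM hX

theorem exists_wellInside_image_mem (hF : IsPrimeFilter M X τ F) {Q : ZFSet.{u}} (hQ : Q ∈ ζ)
    (hQF : image X f (Q ∩ Y) ∈ F) :
    ∃ Q' ∈ ζ, WellInside Z ζ Q' Q ∧ image X f (Q' ∩ Y) ∈ F := by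
  have hζ := hP.isSpace.topology_mem
  let C := ZFSet.sep (fun P => ∃ Q' ∈ ζ, WellInside Z ζ Q' Q ∧ P = image X f (Q' ∩ Y)) τ
  have hC : C ∈ M := hM.sep_mem (.bex hM (.const hζ) (.and
    (.wellInside hM hP.isSpace.carrier_mem hζ (.var _) (.const (hM.mem_of_mem hQ hζ)))
    (.eq (.var _) (.image hM hX.carrier_mem hP.map_mem
      (.inter hM (.var _) (.const hP.carrier_mem)))))) hX.topology_mem
  have hsub : image X f (Q ∩ Y) ⊆ (⋃₀ C : ZFSet.{u}) := by
    rw [image_subset_iff hP.isFunc fun y hy => (ZFSet.mem_inter.1 hy).2]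
    intro y hy
    obtain ⟨hyQ, hyY⟩ := ZFSet.mem_inter.1 hy
    obtain ⟨Q', hQ', hyQ', h⟩ :=
      exists_mem_wellInside hM hP.isSpace hP.isCompactSpace hP.isHausdorff hQ hyQ
    exact ZFSet.mem_sUnion_of_mem (ZFSet.mem_sep.2 ⟨TopInterp.app_mem hP.isFunc hyY, y,
      ZFSet.mem_inter.2 ⟨hyQ', hyY⟩, rfl⟩)
      (ZFSet.mem_sep.2 ⟨hP.image_mem Q' hQ', Q', hQ', h, rfl⟩)
  obtain ⟨P, hPC, hPF⟩ := hF.prime C hC ZFSet.sep_subset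
    (hF.mem_of_subset _ hQF _ (hX.union_open C hC ZFSet.sep_subset) hsub)
  obtain ⟨-, Q', hQ', h, rfl⟩ := ZFSet.mem_sep.1 hPC
  exact ⟨Q', hQ', h, hPF⟩

theorem exists_isShrinking (hF : IsPrimeFilter M X τ F) {I Q : ZFSet.{u}}
    (hI : ∀ Q, image X f (Q ∩ Y) ∈ F → Q ∉ I) (hQ : Q ∈ ζ) (hQF : image X f (Q ∩ Y) ∈ F) :
    ∃ s, IsShrinking Z ζ g I s ∧ s 0 = Q := by
  refine IsShrinking.exists_of_forall_exists (G := ZFSet.sep (fun Q => image X f (Q ∩ Y) ∈ F) ζ)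
    ZFSet.sep_subset (fun Q hQ => hI Q (ZFSet.mem_sep.1 hQ).2) (ZFSet.mem_sep.2 ⟨hQ, hQF⟩) ?_
  intro k P hPF
  obtain ⟨hPζ, hPF⟩ := ZFSet.mem_sep.1 hPF
  have htrace : P ∩ app g (nat k) ∩ Y = P ∩ Y := ZFSet.ext fun z => by
    simp only [ZFSet.mem_inter]
    exact ⟨fun h => ⟨h.1.1, h.2⟩, fun h => ⟨⟨h.1, ((hP.mem_iff z).1 h.2).2 k⟩, h.2⟩⟩
  obtain ⟨P', hP', h, hP'F⟩ := hP.exists_wellInside_image_mem hM hX hF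
    (hP.isSpace.inter_open P hPζ _ (hP.app_mem k)) (htrace.symm ▸ hPF)
  exact ⟨P', ZFSet.mem_sep.2 ⟨hP', hP'F⟩, h⟩

theorem isPrimeFilter_image (hG : IsPrimeFilter M Z ζ G) (hgG : ∀ k, app g (nat k) ∈ G) :
    IsPrimeFilter M X τ (ZFSet.sep (fun P => ∃ Q ∈ G, image X f (Q ∩ Y) ⊆ P) τ) where
  toIsOpenFilter := hX.isOpenFilter_sep (R := fun Q P => image X f (Q ∩ Y) ⊆ P)
    ⟨Z, hG.univ_mem, ZFSet.sep_subset⟩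
    (fun Q hQ Q' hQ' _ _ _ _ h h' => ⟨Q ∩ Q', hG.inter_mem Q hQ Q' hQ', fun x hx =>
      ZFSet.mem_inter.2 ⟨h (image_mono (fun y hy => by
        simp only [ZFSet.mem_inter] at hy ⊢; exact ⟨hy.1.1, hy.2⟩) hx),
        h' (image_mono (fun y hy => by
        simp only [ZFSet.mem_inter] at hy ⊢; exact ⟨hy.1.2, hy.2⟩) hx)⟩⟩)
    fun _ _ _ h h' _ hx => h' (h hx)
  prime K hK hKτ hKG := by
    obtain ⟨-, Q, hQ, hQK⟩ := ZFSet.mem_sep.1 hKG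
    have hζ := hP.isSpace.topology_mem
    let 𝒲 := ZFSet.sep (fun W => ∃ P ∈ K, image X f (W ∩ Y) ⊆ P) ζ
    have h𝒲 : 𝒲 ∈ M := hM.sep_mem (.bex hM (.const hK) (.subset hM (.image hM hX.carrier_mem
      hP.map_mem (.inter hM (.var _) (.const hP.carrier_mem))) (.var _))) hζ
    have hQ𝒲 : ∀ z ∈ Q, (∀ k, z ∈ app g (nat k)) → z ∈ (⋃₀ 𝒲 : ZFSet.{u}) := by
      intro z hz hzg
      have hzY : z ∈ Y := (hP.mem_iff z).2 ⟨hP.isSpace.subset Q (hG.subset hQ) hz, hzg⟩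
      rw [image_subset_iff hP.isFunc fun y hy => (ZFSet.mem_inter.1 hy).2] at hQK
      obtain ⟨P, hPK, hzP⟩ := ZFSet.mem_sUnion.1 (hQK z (ZFSet.mem_inter.2 ⟨hz, hzY⟩))
      obtain ⟨W, hW, hWP, himage⟩ := hP.exists_preimage P (hKτ hPK)
      exact ZFSet.mem_sUnion_of_mem ((hWP z hzY).2 hzP)
        (ZFSet.mem_sep.2 ⟨hW, P, hPK, himage.subset⟩)
    obtain ⟨W, hW, hWG⟩ := hG.prime 𝒲 h𝒲 ZFSet.sep_subset
      (hG.mem_of_inter_subset hM hP.isSpace hP.isCompactSpace hP.isHausdorff hP.sequence_mem hgG hQ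
        (hP.isSpace.union_open 𝒲 h𝒲 ZFSet.sep_subset) hQ𝒲)
    obtain ⟨-, P, hPK, hWP⟩ := ZFSet.mem_sep.1 hW
    exact ⟨P, hPK, ZFSet.mem_sep.2 ⟨hKτ hPK, W, hWG, hWP⟩⟩

/-- The filter `F` need not belong to `N`. It yields a shrinking sequence avoiding an ideal which
belongs to `N`, hence such a sequence in `N`, from which a prime filter is rebuilt in `N`. -/
theorem exists_isPrimeFilter_mem {N : Set ZFSet.{u}} (hN : IsTransitiveModel N) (hMN : M ⊆ N)
    {O : ZFSet.{u}} (hF : IsPrimeFilter M X τ F) (hO : O ∈ F) (hC : C ∈ N) (hCτ : C ⊆ τ)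
    (hFC : ∀ P ∈ C, P ∉ F) : ∃ H ∈ N, IsPrimeFilter M X τ H ∧ O ∈ H ∧ ∀ P ∈ C, P ∉ H := by
  have hζ := hMN hP.isSpace.topology_mem
  have hXN := hMN hX.carrier_mem
  obtain ⟨Q, hQ, -, himage⟩ := hP.exists_preimage O (hF.subset hO)
  obtain ⟨s, hs, hs₀⟩ := hP.exists_isShrinking hM hX hF (I := coverIdeal ζ Y X f C)
    (fun _ => hF.notMem_coverIdeal hM hX hCτ hFC) hQ (himage.symm ▸ hO)
  have hI := hP.coverIdeal_mem hN hMN hXN hC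
  obtain ⟨t, ht, ht₀, b, hb, hbt⟩ :=
    hs.exists_range_mem hN (hMN hP.isSpace.carrier_mem) hζ (hMN hP.sequence_mem) hI
  obtain ⟨G, hGN, hG, hGI, htG⟩ := ht.exists_isPrimeFilter hM hP.isSpace hP.isCompactSpace
    hP.isHausdorff hN hMN hb hbt hI (hP.isOpenIdeal_coverIdeal hM)
  have hQG : Q ∈ G := htG Q hQ 1 (by
    rw [← hs₀, ← ht₀]
    exact (ht.wellInside 0).mono (fun _ hz => hz) fun z hz => (ZFSet.mem_inter.1 hz).1)
  have hgG (k : ℕ) : app g (nat k) ∈ G := htG _ (hP.app_mem k) (k + 1)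
    ((ht.wellInside k).mono (fun _ hz => hz) fun z hz => (ZFSet.mem_inter.1 hz).2)
  refine ⟨_, hN.sep_mem (.bex hN (.const hGN) (.subset hN (.image hN hXN (hMN hP.map_mem)
    (.inter hN (.var _) (.const (hMN hP.carrier_mem)))) (.var _))) (hMN hX.topology_mem),
    hP.isPrimeFilter_image hM hX hG hgG,
    ZFSet.mem_sep.2 ⟨hF.subset hO, Q, hQG, himage.subset⟩, fun P hPC hPG => ?_⟩
  obtain ⟨-, W, hW, hWP⟩ := ZFSet.mem_sep.1 hPG
  refine hGI W hW (ZFSet.mem_sep.2 ⟨hG.subset hW, {P}, by simp, fun P' hP' => ?_, ?_⟩)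
  · rwa [ZFSet.mem_singleton.1 hP']
  · rwa [ZFSet.sUnion_singleton]

end Model

end IsCechPresentation

/-! ### Points of interpretations -/

section Preinterpretation

variable {N : Set ZFSet.{u}} {X τ Y σ p q : ZFSet.{u}}

theorem IsSpace.isPrimeFilter_sep_mem (hX : IsSpace M X τ) {x : ZFSet.{u}} (hx : x ∈ X) :
    IsPrimeFilter M X τ (ZFSet.sep (fun O => x ∈ O) τ) where
  subset := ZFSet.sep_subset
  univ_mem := ZFSet.mem_sep.2 ⟨hX.univ_open, hx⟩
  inter_mem O hO P hP := by
    rw [ZFSet.mem_sep] at hO hP ⊢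
    exact ⟨hX.inter_open _ hO.1 _ hP.1, ZFSet.mem_inter.2 ⟨hO.2, hP.2⟩⟩
  mem_of_subset O hO P hP hOP := ZFSet.mem_sep.2 ⟨hP, hOP (ZFSet.mem_sep.1 hO).2⟩
  prime C _ hCτ hC := by
    obtain ⟨O, hO, hx⟩ := ZFSet.mem_sUnion.1 (ZFSet.mem_sep.1 hC).2
    exact ⟨O, hO, ZFSet.mem_sep.2 ⟨hCτ hO, hx⟩⟩

namespace IsPreinterpretation

theorem mono (h : IsPreinterpretation N M X τ Y σ p q) {O P : ZFSet.{u}} (hO : O ∈ τ) (hP : P ∈ τ)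
    (hOP : O ⊆ P) : app q O ⊆ app q P := by
  have hinter := h.map_inter O hO P hP
  rw [ZFSet.inter_eq_left_of_subset hOP] at hinter
  exact fun y hy => (ZFSet.mem_inter.1 (hinter ▸ hy)).2

theorem subset_of_app_subset (h : IsPreinterpretation N M X τ Y σ p q) {O P : ZFSet.{u}}
    (hO : O ∈ τ) (hP : P ∈ τ) (hOP : app q O ⊆ app q P) : O ⊆ P := fun x hx =>
  have hxX := h.source.subset O hO hx
  (h.mem_iff x hxX P hP).2 (hOP ((h.mem_iff x hxX O hO).1 hx))

theorem eq_of_forall_mem_app_iff (h : IsPreinterpretation N M X τ Y σ p q) {y z : ZFSet.{u}}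
    (hy : y ∈ Y) (hz : z ∈ Y) (hyz : ∀ O ∈ τ, y ∈ app q O ↔ z ∈ app q O) : y = z := by
  refine h.target.t0 y hy z hz fun U hU => ⟨fun hyU => ?_, fun hzU => ?_⟩
  · obtain ⟨O, hO, hyO, hOU⟩ := h.basis U hU y hyU
    exact hOU ((hyz O hO).1 hyO)
  · obtain ⟨O, hO, hzO, hOU⟩ := h.basis U hU z hzU
    exact hOU ((hyz O hO).2 hzO)

theorem isPrimeFilter_sep_mem_app (h : IsPreinterpretation N M X τ Y σ p q) {y : ZFSet.{u}}
    (hy : y ∈ Y) : IsPrimeFilter M X τ (ZFSet.sep (fun O => y ∈ app q O) τ) where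
  subset := ZFSet.sep_subset
  univ_mem := ZFSet.mem_sep.2 ⟨h.source.univ_open, by rwa [h.map_univ]⟩
  inter_mem O hO P hP := by
    rw [ZFSet.mem_sep] at hO hP ⊢
    rw [h.map_inter O hO.1 P hP.1]
    exact ⟨h.source.inter_open _ hO.1 _ hP.1, ZFSet.mem_inter.2 ⟨hO.2, hP.2⟩⟩
  mem_of_subset O hO P hP hOP := by
    rw [ZFSet.mem_sep] at hO
    exact ZFSet.mem_sep.2 ⟨hP, h.mono hO.1 hP hOP hO.2⟩
  prime C hC hCτ hCF := by
    obtain ⟨O, hO, hy⟩ := (h.map_union C hC hCτ y).1 (ZFSet.mem_sep.1 hCF).2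
    exact ⟨O, hO, ZFSet.mem_sep.2 ⟨hCτ hO, hy⟩⟩

end IsPreinterpretation

end Preinterpretation

/-! ### The space of prime filters -/

/-- The completely prime filters over `M` on `⟨X, τ⟩` which belong to `N`: the points of the
largest preinterpretation of `⟨X, τ⟩` in `N`. -/
def filterSpace (N M : Set ZFSet.{u}) (X τ : ZFSet.{u}) : ZFSet.{u} :=
  ZFSet.sep (fun F => F ∈ N ∧ IsPrimeFilter M X τ F) τ.powerset

/-- The interpretation of the open set `O` in the space of prime filters. -/
def basicOpen (N M : Set ZFSet.{u}) (X τ O : ZFSet.{u}) : ZFSet.{u} :=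
  ZFSet.sep (fun F => O ∈ F) (filterSpace N M X τ)

/-- The topology of the space of prime filters, generated in `N` by the sets `basicOpen N M X τ O`
with `O ∈ τ`. -/
def filterTopology (N M : Set ZFSet.{u}) (X τ : ZFSet.{u}) : ZFSet.{u} :=
  ZFSet.sep (fun U => U ∈ N ∧ ∀ F ∈ U, ∃ O ∈ F, basicOpen N M X τ O ⊆ U)
    (filterSpace N M X τ).powerset

section FilterSpace

variable {N : Set ZFSet.{u}} {X τ F O P U : ZFSet.{u}}

theorem mem_filterSpace : F ∈ filterSpace N M X τ ↔ F ∈ N ∧ IsPrimeFilter M X τ F := by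
  rw [filterSpace, ZFSet.mem_sep, ZFSet.mem_powerset]
  exact and_iff_right_of_imp fun h => h.2.subset

theorem mem_basicOpen :
    F ∈ basicOpen N M X τ O ↔ (F ∈ N ∧ IsPrimeFilter M X τ F) ∧ O ∈ F := by
  rw [basicOpen, ZFSet.mem_sep, mem_filterSpace]

theorem mem_filterTopology : U ∈ filterTopology N M X τ ↔
    U ⊆ filterSpace N M X τ ∧ U ∈ N ∧ ∀ F ∈ U, ∃ O ∈ F, basicOpen N M X τ O ⊆ U := by
  rw [filterTopology, ZFSet.mem_sep, ZFSet.mem_powerset]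

theorem basicOpen_mono (hP : P ∈ τ) (hOP : O ⊆ P) :
    basicOpen N M X τ O ⊆ basicOpen N M X τ P := fun F hF => by
  rw [mem_basicOpen] at hF ⊢
  exact ⟨hF.1, hF.1.2.mem_of_subset O hF.2 P hP hOP⟩

theorem basicOpen_inter (hO : O ∈ τ) (hP : P ∈ τ) :
    basicOpen N M X τ (O ∩ P) = basicOpen N M X τ O ∩ basicOpen N M X τ P := by
  ext F
  simp only [ZFSet.mem_inter, mem_basicOpen]
  constructor
  · exact fun ⟨hF, h⟩ => ⟨⟨hF, hF.2.mem_of_subset _ h O hO fun _ hz => (ZFSet.mem_inter.1 hz).1⟩,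
      hF, hF.2.mem_of_subset _ h P hP fun _ hz => (ZFSet.mem_inter.1 hz).2⟩
  · exact fun ⟨⟨hF, h⟩, _, h'⟩ => ⟨hF, hF.2.inter_mem O h P h'⟩

theorem mem_basicOpen_sUnion {C : ZFSet.{u}} (hX : IsSpace M X τ) (hC : C ∈ M) (hCτ : C ⊆ τ) :
    F ∈ basicOpen N M X τ (⋃₀ C) ↔ ∃ O ∈ C, F ∈ basicOpen N M X τ O := by
  refine ⟨fun h => ?_, fun ⟨O, hO, hF⟩ => basicOpen_mono (hX.union_open C hC hCτ)
    (fun z hz => ZFSet.mem_sUnion_of_mem hz hO) hF⟩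
  rw [mem_basicOpen] at h
  obtain ⟨O, hO, hOF⟩ := h.1.2.prime C hC hCτ h.2
  exact ⟨O, hO, mem_basicOpen.2 ⟨h.1, hOF⟩⟩

theorem basicOpen_empty (hM : IsTransitiveModel M) (hX : IsSpace M X τ) :
    basicOpen N M X τ ∅ = ∅ := by
  rw [ZFSet.eq_empty]
  intro F hF
  rw [← ZFSet.sUnion_empty, mem_basicOpen_sUnion hX hM.empty_mem (by simp)] at hF
  obtain ⟨O, hO, -⟩ := hF
  exact ZFSet.notMem_empty O hO

theorem basicOpen_univ : basicOpen N M X τ X = filterSpace N M X τ := by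
  ext F
  rw [mem_basicOpen, mem_filterSpace]
  exact and_iff_left_of_imp fun h => h.2.univ_mem

variable (hM : IsTransitiveModel M) (hN : IsTransitiveModel N) (hMN : M ⊆ N) (hX : IsSpace M X τ)
include hM hN hMN hX

theorem definable_isPrimeFilter : IsDefinable N fun v : Fin 1 → N => IsPrimeFilter M X τ (v 0) := by
  have hτ := hMN hX.topology_mem
  refine IsDefinable.congr (φ := fun v => (v 0 : ZFSet.{u}) ⊆ τ ∧ X ∈ (v 0 : ZFSet.{u}) ∧
      (∀ O ∈ (v 0 : ZFSet.{u}), ∀ P ∈ (v 0 : ZFSet.{u}), O ∩ P ∈ (v 0 : ZFSet.{u})) ∧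
      (∀ O ∈ (v 0 : ZFSet.{u}), ∀ P ∈ τ, O ⊆ P → P ∈ (v 0 : ZFSet.{u})) ∧
      ∀ C ∈ ZFSet.sep (· ∈ M) τ.powerset, (⋃₀ C : ZFSet.{u}) ∈ (v 0 : ZFSet.{u}) →
        ∃ O ∈ C, O ∈ (v 0 : ZFSet.{u}))
    (.and (.subset hN (.var _) (.const hτ)) (.and (.mem (.const (hMN hX.carrier_mem)) (.var _))
      (.and (.ball hN (.var _) (.ball hN (.var _) (.mem (.inter hN (.var _) (.var _)) (.var _))))
        (.and (.ball hN (.var _) (.ball hN (.const hτ)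
          (.imp (.subset hN (.var _) (.var _)) (.mem (.var _) (.var _)))))
          (.ball hN (.const (hMN (hM.sep_powerset_mem hX.topology_mem)))
            (.imp (.mem (.sUnion hN (.var _)) (.var _))
              (.bex hN (.var _) (.mem (.var _) (.var _))))))))) fun v => ?_
  simp only [ZFSet.mem_sep, ZFSet.mem_powerset]
  exact ⟨fun h => ⟨h.subset, h.univ_mem, h.inter_mem, h.mem_of_subset,
    fun C hC => h.prime C hC.2 hC.1⟩, fun ⟨hsub, huniv, hinter, hup, hprime⟩ =>
    ⟨⟨hsub, huniv, hinter, hup⟩, fun C hC hCτ => hprime C ⟨hCτ, hC⟩⟩⟩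

theorem filterSpace_mem : filterSpace N M X τ ∈ N :=
  hN.sep_powerset_sep_mem (definable_isPrimeFilter hM hN hMN hX) (hMN hX.topology_mem)

theorem definableMap_basicOpen {t : (Fin n → N) → ZFSet.{u}} (ht : IsDefinableMap N t) :
    IsDefinableMap N fun v => basicOpen N M X τ (t v) :=
  .sep hN (φ := fun v F => t v ∈ F) (.mem ht.lift (.var _)) (.const (filterSpace_mem hM hN hMN hX))

theorem filterTopology_mem : filterTopology N M X τ ∈ N :=
  hN.sep_powerset_sep_mem (.ball hN (.var _) (.bex hN (.var _)
    (.subset hN (definableMap_basicOpen hM hN hMN hX (.var _)) (.var _))))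
    (filterSpace_mem hM hN hMN hX)

theorem basicOpen_mem_filterTopology (hO : O ∈ τ) :
    basicOpen N M X τ O ∈ filterTopology N M X τ :=
  mem_filterTopology.2 ⟨ZFSet.sep_subset,
    hN.sep_mem (.mem (.const (hN.mem_of_mem hO (hMN hX.topology_mem))) (.var _))
      (filterSpace_mem hM hN hMN hX),
    fun _ hF => ⟨O, (mem_basicOpen.1 hF).2, fun _ h => h⟩⟩

theorem isSpace_filterSpace : IsSpace N (filterSpace N M X τ) (filterTopology N M X τ) where
  carrier_mem := filterSpace_mem hM hN hMN hX
  topology_mem := filterTopology_mem hM hN hMN hX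
  subset U hU := (mem_filterTopology.1 hU).1
  empty_open := basicOpen_empty (N := N) hM hX ▸
    basicOpen_mem_filterTopology hM hN hMN hX hX.empty_open
  univ_open := basicOpen_univ (N := N) (X := X) ▸
    basicOpen_mem_filterTopology hM hN hMN hX hX.univ_open
  inter_open U hU V hV := by
    obtain ⟨hUS, hUN, hU⟩ := mem_filterTopology.1 hU
    obtain ⟨-, hVN, hV⟩ := mem_filterTopology.1 hV
    refine mem_filterTopology.2 ⟨fun F hF => hUS (ZFSet.mem_inter.1 hF).1, hN.inter_mem hUN hVN,
      fun F hF => ?_⟩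
    rw [ZFSet.mem_inter] at hF
    obtain ⟨O, hO, hOU⟩ := hU F hF.1
    obtain ⟨P, hP, hPV⟩ := hV F hF.2
    have hFp := (mem_filterSpace.1 (hUS hF.1)).2
    refine ⟨O ∩ P, hFp.inter_mem O hO P hP, ?_⟩
    rw [basicOpen_inter (hFp.subset hO) (hFp.subset hP)]
    exact fun F' hF' => ZFSet.mem_inter.2 ((ZFSet.mem_inter.1 hF').imp (hOU ·) (hPV ·))
  union_open C hC hCσ := by
    have hC' (U : ZFSet.{u}) (hU : U ∈ C) := mem_filterTopology.1 (hCσ hU)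
    refine mem_filterTopology.2 ⟨fun F hF => ?_, hN.sUnion_mem hC, fun F hF => ?_⟩ <;>
      obtain ⟨U, hU, hFU⟩ := ZFSet.mem_sUnion.1 hF
    · exact (hC' U hU).1 hFU
    · obtain ⟨O, hO, hOU⟩ := (hC' U hU).2.2 F hFU
      exact ⟨O, hO, fun F' hF' => ZFSet.mem_sUnion_of_mem (hOU hF') hU⟩
  t0 F hF F' hF' h := by
    have hFp := mem_filterSpace.1 hF
    have hFp' := mem_filterSpace.1 hF'
    have hiff (O : ZFSet.{u}) (hO : O ∈ τ) : O ∈ F ↔ O ∈ F' := by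
      simpa only [mem_basicOpen, hFp, hFp', true_and] using
        h _ (basicOpen_mem_filterTopology hM hN hMN hX hO)
    exact ZFSet.ext fun O => ⟨fun hO => (hiff O (hFp.2.subset hO)).1 hO,
      fun hO => (hiff O (hFp'.2.subset hO)).2 hO⟩

theorem exists_isPreinterpretation_filterSpace : ∃ p q,
    IsPreinterpretation N M X τ (filterSpace N M X τ) (filterTopology N M X τ) p q ∧
      ∀ O ∈ τ, app q O = basicOpen N M X τ O := by
  have hXN := hMN hX.carrier_mem
  have hτ := hMN hX.topology_mem
  obtain ⟨p, hp, hpf, hpx⟩ := hN.exists_isFunc_app_eq hXN (filterSpace_mem hM hN hMN hX)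
    (t := fun x => ZFSet.sep (fun O => x ∈ O) τ)
    (.sep hN (φ := fun v O => (v 0 : ZFSet.{u}) ∈ O) (.mem (.var _) (.var _)) (.const hτ))
    fun x hx => mem_filterSpace.2 ⟨hN.sep_mem
      (.mem (.const (hN.mem_of_mem hx hXN)) (.var _)) hτ, hX.isPrimeFilter_sep_mem hx⟩
  obtain ⟨q, hq, hqf, hqO⟩ := hN.exists_isFunc_app_eq hτ (filterTopology_mem hM hN hMN hX)
    (definableMap_basicOpen hM hN hMN hX (.var _))
    fun O hO => basicOpen_mem_filterTopology hM hN hMN hX hO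
  refine ⟨p, q, ⟨hX, isSpace_filterSpace hM hN hMN hX, hp, hq, hpf, hqf, fun x hx O hO => ?_,
    fun O hO P hP => ?_, fun C hC hCτ F => ?_, ?_, ?_, fun U hU F hF => ?_⟩, hqO⟩
  · have hpx' := mem_filterSpace.1 (app_mem hpf hx)
    rw [hqO O hO, mem_basicOpen, and_iff_right hpx', hpx x hx, ZFSet.mem_sep, and_iff_right hO]
  · rw [hqO _ (hX.inter_open O hO P hP), hqO O hO, hqO P hP, basicOpen_inter hO hP]
  · rw [hqO _ (hX.union_open C hC hCτ), mem_basicOpen_sUnion hX hC hCτ]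
    exact exists_congr fun O => and_congr_right fun hO => by rw [hqO O (hCτ hO)]
  · rw [hqO _ hX.empty_open, basicOpen_empty hM hX]
  · rw [hqO _ hX.univ_open, basicOpen_univ]
  · obtain ⟨hUS, -, hU⟩ := mem_filterTopology.1 hU
    obtain ⟨O, hO, hOU⟩ := hU F hF
    have hFp := mem_filterSpace.1 (hUS hF)
    have hOτ := hFp.2.subset hO
    exact ⟨O, hOτ, hqO O hOτ ▸ mem_basicOpen.2 ⟨hFp, hO⟩, hqO O hOτ ▸ hOU⟩

end FilterSpace

section Interpretation

variable {N : Set ZFSet.{u}} {X τ Y σ p q : ZFSet.{u}}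

theorem IsPreinterpretation.exists_isReduction (h : IsPreinterpretation N M X τ Y σ p q)
    (hN : IsTransitiveModel N) (hMN : M ⊆ N) {Y' σ' p' q' : ZFSet.{u}}
    (h' : IsPreinterpretation N M X τ Y' σ' p' q')
    (hpt : ∀ y' ∈ Y', ∃ y ∈ Y, ∀ O ∈ τ, y ∈ app q O ↔ y' ∈ app q' O) :
    ∃ r ∈ N, IsReduction X τ Y' p' q' Y p q r := by
  have hτ := hMN h.source.topology_mem
  obtain ⟨r, hr, hrf, hrO⟩ := hN.exists_isFunc h'.target.carrier_mem h.target.carrier_mem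
    (ρ := fun y' y => ∀ O ∈ τ, y ∈ app q O ↔ y' ∈ app q' O)
    (.ball hN (.const hτ) (.iff (.mem (.var _) (.app hN (.const h.opens_mem) (.var _)))
      (.mem (.var _) (.app hN (.const h'.opens_mem) (.var _))))) fun y' hy' => by
    obtain ⟨y, hy, hyO⟩ := hpt y' hy'
    exact ⟨y, ⟨hy, hyO⟩, fun z ⟨hz, hzO⟩ =>
      h.eq_of_forall_mem_app_iff hz hy fun O hO => (hzO O hO).trans (hyO O hO).symm⟩
  refine ⟨r, hr, hrf, fun x hx => ?_, fun O hO y' hy' => hrO y' hy' O hO⟩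
  have hx' := app_mem h'.points_isFunc hx
  exact h.eq_of_forall_mem_app_iff (app_mem hrf hx') (app_mem h.points_isFunc hx) fun O hO => by
    rw [hrO _ hx' O hO, ← h'.mem_iff x hx O hO, ← h.mem_iff x hx O hO]

theorem IsPreinterpretation.isInterpretation_iff (h : IsPreinterpretation N M X τ Y σ p q)
    (hM : IsTransitiveModel M) (hN : IsTransitiveModel N) (hMN : M ⊆ N) :
    IsInterpretation N M X τ Y σ p q ↔
      ∀ F ∈ N, IsPrimeFilter M X τ F → ∃ y ∈ Y, ∀ O ∈ τ, y ∈ app q O ↔ O ∈ F := by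
  refine ⟨fun hI F hFN hF => ?_, fun hreal => ⟨h, fun Y' σ' p' q' h' =>
    h.exists_isReduction hN hMN h' fun y' hy' => ?_⟩⟩
  · obtain ⟨p', q', h', hq'⟩ := exists_isPreinterpretation_filterSpace hM hN hMN h.source
    obtain ⟨r, -, hr⟩ := hI.2 _ _ _ _ h'
    have hFS : F ∈ filterSpace N M X τ := mem_filterSpace.2 ⟨hFN, hF⟩
    refine ⟨app r F, app_mem hr.isFunc hFS, fun O hO => ?_⟩
    rw [hr.preimage_eq O hO F hFS, hq' O hO, mem_basicOpen, and_iff_right ⟨hFN, hF⟩]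
  · have hy'N := hN.mem_of_mem hy' h'.target.carrier_mem
    obtain ⟨y, hy, hyO⟩ := hreal _ (hN.sep_mem (φ := fun O => y' ∈ app q' O)
      (.mem (.const hy'N) (.app hN (.const h'.opens_mem) (.var _))) (hMN h.source.topology_mem))
      (h'.isPrimeFilter_sep_mem_app hy')
    exact ⟨y, hy, fun O hO => by rw [hyO O hO, ZFSet.mem_sep, and_iff_right hO]⟩

end Interpretation

/-! ### Composition -/

section Comp

variable {A B C f g x z : ZFSet.{u}} (hf : ZFSet.IsFunc A B f) (hg : ZFSet.IsFunc B C g)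
include hf hg

theorem pair_mem_comp (hx : x ∈ A) :
    ZFSet.pair x z ∈ comp A C g f ↔ z = app g (app f x) := by
  rw [comp, ZFSet.mem_sep, ZFSet.pair_mem_prod]
  constructor
  · rintro ⟨-, x', y, z', hxz, hy, hz⟩
    obtain ⟨rfl, rfl⟩ := ZFSet.pair_inj.1 hxz
    rw [app_eq hf hy, app_eq hg hz]
  · rintro rfl
    have hfx := app_mem hf hx
    exact ⟨⟨hx, app_mem hg hfx⟩, x, _, _, rfl, (pair_mem_iff hf hx).2 rfl,
      (pair_mem_iff hg hfx).2 rfl⟩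

theorem comp_isFunc : ZFSet.IsFunc A C (comp A C g f) :=
  ⟨ZFSet.sep_subset, fun _ hx => ⟨_, (pair_mem_comp hf hg hx).2 rfl,
    fun _ => (pair_mem_comp hf hg hx).1⟩⟩

theorem app_comp (hx : x ∈ A) : app (comp A C g f) x = app g (app f x) :=
  app_eq (comp_isFunc hf hg) ((pair_mem_comp hf hg hx).2 rfl)

theorem IsTransitiveModel.comp_mem (hM : IsTransitiveModel M) (hA : A ∈ M) (hC : C ∈ M)
    (hfM : f ∈ M) (hgM : g ∈ M) : comp A C g f ∈ M := by
  convert hM.sep_mem (φ := fun w => ∃ x ∈ A, w = ZFSet.pair x (TopInterp.app g (TopInterp.app f x)))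
    (.bex hM (.const hA) (.eq (.var _) (.pair hM (.var _)
      (.app hM (.const hgM) (.app hM (.const hfM) (.var _)))))) (hM.prod_mem hA hC) using 1
  ext w
  rw [ZFSet.mem_sep, ZFSet.mem_prod]
  constructor
  · intro hw
    obtain ⟨x, hx, z, hz, rfl⟩ := ZFSet.mem_prod.1 (ZFSet.mem_sep.1 hw).1
    exact ⟨⟨x, hx, z, hz, rfl⟩, x, hx, by rw [(pair_mem_comp hf hg hx).1 hw]⟩
  · rintro ⟨-, x, hx, rfl⟩
    exact (pair_mem_comp hf hg hx).2 rfl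

end Comp

namespace IsPreinterpretation

variable {M₀ M₁ N : Set ZFSet.{u}} {X₀ τ₀ X₁ τ₁ X₂ τ₂ p₀ q₀ p₁ q₁ C U : ZFSet.{u}}

section Image

variable (h₀ : IsPreinterpretation M₁ M₀ X₀ τ₀ X₁ τ₁ p₀ q₀)
include h₀

theorem sUnion_image (hC : C ∈ M₀) (hCτ : C ⊆ τ₀) :
    (⋃₀ image τ₁ q₀ C : ZFSet.{u}) = app q₀ (⋃₀ C) := by
  ext y
  rw [h₀.map_union C hC hCτ]
  simp only [image, ZFSet.mem_sUnion, ZFSet.mem_sep]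
  constructor
  · rintro ⟨_, ⟨-, O, hO, rfl⟩, hy⟩
    exact ⟨O, hO, hy⟩
  · rintro ⟨O, hO, hy⟩
    exact ⟨_, ⟨app_mem h₀.opens_isFunc (hCτ hO), O, hO, rfl⟩, hy⟩

theorem sUnion_image_sep (hU : U ∈ τ₁) :
    (⋃₀ image τ₁ q₀ (ZFSet.sep (fun O => app q₀ O ⊆ U) τ₀) : ZFSet.{u}) = U := by
  ext y
  simp only [image, ZFSet.mem_sUnion, ZFSet.mem_sep]
  constructor
  · rintro ⟨_, ⟨-, O, ⟨-, hOU⟩, rfl⟩, hy⟩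
    exact hOU hy
  · intro hy
    obtain ⟨O, hO, hyO, hOU⟩ := h₀.basis U hU y hy
    exact ⟨_, ⟨app_mem h₀.opens_isFunc hO, O, ⟨hO, hOU⟩, rfl⟩, hyO⟩

theorem mem_app_sUnion_image (hM₁ : IsTransitiveModel M₁)
    (h₁ : IsPreinterpretation N M₁ X₁ τ₁ X₂ τ₂ p₁ q₁) (hC : C ∈ M₁) (hCτ : C ⊆ τ₀) {z : ZFSet.{u}} :
    z ∈ app q₁ (⋃₀ image τ₁ q₀ C) ↔ ∃ O ∈ C, z ∈ app q₁ (app q₀ O) := by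
  have himage : image τ₁ q₀ C ∈ M₁ := hM₁.sep_mem (.bex hM₁ (.const hC)
    (.eq (.app hM₁ (.const h₀.opens_mem) (.var _)) (.var _))) h₀.target.topology_mem
  rw [h₁.map_union _ himage ZFSet.sep_subset]
  simp only [image, ZFSet.mem_sep]
  constructor
  · rintro ⟨_, ⟨-, O, hO, rfl⟩, hz⟩
    exact ⟨O, hO, hz⟩
  · rintro ⟨O, hO, hz⟩
    exact ⟨_, ⟨app_mem h₀.opens_isFunc (hCτ hO), O, hO, rfl⟩, hz⟩

end Image

theorem comp (hM₁ : IsTransitiveModel M₁) (hN : IsTransitiveModel N) (h₀₁ : M₀ ⊆ M₁)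
    (h₁N : M₁ ⊆ N) (h₀ : IsPreinterpretation M₁ M₀ X₀ τ₀ X₁ τ₁ p₀ q₀)
    (h₁ : IsPreinterpretation N M₁ X₁ τ₁ X₂ τ₂ p₁ q₁) :
    IsPreinterpretation N M₀ X₀ τ₀ X₂ τ₂ (TopInterp.comp X₀ X₂ p₁ p₀)
      (TopInterp.comp τ₀ τ₂ q₁ q₀) := by
  have hX₀ := h₀.source
  have hτ₀ := h₀₁ hX₀.topology_mem
  have hp {x : ZFSet.{u}} (hx : x ∈ X₀) := app_comp h₀.points_isFunc h₁.points_isFunc hx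
  have hq {O : ZFSet.{u}} (hO : O ∈ τ₀) := app_comp h₀.opens_isFunc h₁.opens_isFunc hO
  have hq₀ {O : ZFSet.{u}} (hO : O ∈ τ₀) : app q₀ O ∈ τ₁ := app_mem h₀.opens_isFunc hO
  refine ⟨hX₀, h₁.target, hN.comp_mem h₀.points_isFunc h₁.points_isFunc
    (h₁N (h₀₁ hX₀.carrier_mem)) h₁.target.carrier_mem (h₁N h₀.points_mem) h₁.points_mem,
    hN.comp_mem h₀.opens_isFunc h₁.opens_isFunc (h₁N hτ₀) h₁.target.topology_mem
    (h₁N h₀.opens_mem) h₁.opens_mem, comp_isFunc h₀.points_isFunc h₁.points_isFunc,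
    comp_isFunc h₀.opens_isFunc h₁.opens_isFunc, fun x hx O hO => ?_, fun O hO P hP => ?_,
    fun C hC hCτ z => ?_, ?_, ?_, fun V hV z hz => ?_⟩
  · rw [hp hx, hq hO, h₀.mem_iff x hx O hO,
      h₁.mem_iff _ (app_mem h₀.points_isFunc hx) _ (hq₀ hO)]
  · rw [hq hO, hq hP, hq (hX₀.inter_open O hO P hP), h₀.map_inter O hO P hP,
      h₁.map_inter _ (hq₀ hO) _ (hq₀ hP)]
  · rw [hq (hX₀.union_open C hC hCτ), ← h₀.sUnion_image hC hCτ,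
      h₀.mem_app_sUnion_image hM₁ h₁ (h₀₁ hC) hCτ]
    exact exists_congr fun O => and_congr_right fun hO => by rw [hq (hCτ hO)]
  · rw [hq hX₀.empty_open, h₀.map_empty, h₁.map_empty]
  · rw [hq hX₀.univ_open, h₀.map_univ, h₁.map_univ]
  · obtain ⟨U, hU, hzU, hUV⟩ := h₁.basis V hV z hz
    have hC : ZFSet.sep (fun O => app q₀ O ⊆ U) τ₀ ∈ M₁ := hM₁.sep_mem
      (.subset hM₁ (.app hM₁ (.const h₀.opens_mem) (.var _))
        (.const (hM₁.mem_of_mem hU h₀.target.topology_mem))) hτ₀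
    rw [← h₀.sUnion_image_sep hU, h₀.mem_app_sUnion_image hM₁ h₁ hC ZFSet.sep_subset] at hzU
    obtain ⟨O, hO, hzO⟩ := hzU
    obtain ⟨hO, hOU⟩ := ZFSet.mem_sep.1 hO
    rw [← hq hO] at hzO
    exact ⟨O, hO, hzO, fun w hw => hUV (h₁.mono (hq₀ hO) hU hOU (hq hO ▸ hw))⟩

end IsPreinterpretation

/-! ### Generated filters -/

/-- The filter on `⟨X₁, τ₁⟩` generated by the interpretations `q₀(O)` of the members `O` of a filter
`F` on `⟨X₀, τ₀⟩`. -/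
noncomputable def generatedFilter (τ₁ q₀ F : ZFSet.{u}) : ZFSet.{u} :=
  ZFSet.sep (fun U => ∃ O ∈ F, app q₀ O ⊆ U) τ₁

section GeneratedFilter

variable {M₀ M₁ : Set ZFSet.{u}} {X₀ τ₀ X₁ τ₁ p₀ q₀ F : ZFSet.{u}}

theorem IsPreinterpretation.app_mem_generatedFilter_iff
    (h₀ : IsPreinterpretation M₁ M₀ X₀ τ₀ X₁ τ₁ p₀ q₀) (hF : IsOpenFilter X₀ τ₀ F) {O : ZFSet.{u}}
    (hO : O ∈ τ₀) : app q₀ O ∈ generatedFilter τ₁ q₀ F ↔ O ∈ F := by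
  rw [generatedFilter, ZFSet.mem_sep, and_iff_right (app_mem h₀.opens_isFunc hO)]
  exact ⟨fun ⟨P, hP, hPO⟩ => hF.mem_of_subset P hP O hO
    (h₀.subset_of_app_subset (hF.subset hP) hO hPO), fun h => ⟨O, h, fun _ hy => hy⟩⟩

theorem IsTransitiveModel.generatedFilter_mem (hM : IsTransitiveModel M) (hτ₁ : τ₁ ∈ M)
    (hq₀ : q₀ ∈ M) (hF : F ∈ M) : generatedFilter τ₁ q₀ F ∈ M :=
  hM.sep_mem (.bex hM (.const hF) (.subset hM (.app hM (.const hq₀) (.var _)) (.var _))) hτ₁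

theorem IsPreinterpretation.isOpenFilter_generatedFilter
    (h₀ : IsPreinterpretation M₁ M₀ X₀ τ₀ X₁ τ₁ p₀ q₀) (hF : IsOpenFilter X₀ τ₀ F) :
    IsOpenFilter X₁ τ₁ (generatedFilter τ₁ q₀ F) :=
  h₀.target.isOpenFilter_sep (R := fun O U => app q₀ O ⊆ U)
    ⟨X₀, hF.univ_mem, h₀.map_univ.subset⟩
    (fun O hO P hP U _ V _ hOU hPV => ⟨O ∩ P, hF.inter_mem O hO P hP, by
      rw [h₀.map_inter O (hF.subset hO) P (hF.subset hP)]
      exact fun y hy => ZFSet.mem_inter.2 ((ZFSet.mem_inter.1 hy).imp (hOU ·) (hPV ·))⟩)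
    fun _ _ _ h h' _ hy => h' (h hy)

variable (hM₀ : IsTransitiveModel M₀) (hM₁ : IsTransitiveModel M₁) (h₀₁ : M₀ ⊆ M₁)
include hM₀ hM₁ h₀₁

theorem IsInterpretation.isPrimeFilter_generatedFilter
    (hI : IsInterpretation M₁ M₀ X₀ τ₀ X₁ τ₁ p₀ q₀) {Z ζ g Y f : ZFSet.{u}}
    (hP : IsCechPresentation M₀ Z ζ g Y X₀ τ₀ f) (hF : IsPrimeFilter M₀ X₀ τ₀ F) :
    IsPrimeFilter M₁ X₁ τ₁ (generatedFilter τ₁ q₀ F) where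
  toIsOpenFilter := hI.1.isOpenFilter_generatedFilter hF.toIsOpenFilter
  prime C hC hCτ hCF := by
    have h₀ := hI.1
    obtain ⟨-, O, hO, hOC⟩ := ZFSet.mem_sep.1 hCF
    let D := ZFSet.sep (fun P => ∃ U ∈ C, app q₀ P ⊆ U) τ₀
    have hD : D ∈ M₁ := hM₁.sep_mem (.bex hM₁ (.const hC)
      (.subset hM₁ (.app hM₁ (.const h₀.opens_mem) (.var _)) (.var _)))
      (h₀₁ h₀.source.topology_mem)
    by_contra! hC'
    have hFD : ∀ P ∈ D, P ∉ F := fun P hPD hPF => by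
      obtain ⟨-, U, hU, hPU⟩ := ZFSet.mem_sep.1 hPD
      exact hC' U hU (ZFSet.mem_sep.2 ⟨hCτ hU, P, hPF, hPU⟩)
    obtain ⟨H, hHM, hH, hOH, hHD⟩ :=
      hP.exists_isPrimeFilter_mem hM₀ h₀.source hM₁ h₀₁ hF hO hD ZFSet.sep_subset hFD
    obtain ⟨y, -, hyH⟩ := (h₀.isInterpretation_iff hM₀ hM₁ h₀₁).1 hI H hHM hH
    obtain ⟨U, hU, hyU⟩ := ZFSet.mem_sUnion.1 (hOC ((hyH O (hF.subset hO)).2 hOH))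
    obtain ⟨P, hPτ, hyP, hPU⟩ := h₀.basis U (hCτ hU) y hyU
    exact hHD P (ZFSet.mem_sep.2 ⟨hPτ, U, hU, hPU⟩) ((hyH P hPτ).1 hyP)

end GeneratedFilter

end TopInterp

open TopInterp in
theorem mainTheorem8_general {M₀ M₁ M₂ : Set ZFSet.{u}} (hM₀ : IsTransitiveModel M₀)
    (hM₁ : IsTransitiveModel M₁) (hM₂ : IsTransitiveModel M₂) (h₀₁ : M₀ ⊆ M₁) (h₁₂ : M₁ ⊆ M₂)
    {X₀ τ₀ X₁ τ₁ X₂ τ₂ p₀ q₀ p₁ q₁ Y υ f : ZFSet.{u}} (hY : IsCechComplete M₀ Y υ) (hf : f ∈ M₀)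
    (hfs : IsOpenContinuousSurjection Y υ X₀ τ₀ f)
    (hπ₀ : IsInterpretation M₁ M₀ X₀ τ₀ X₁ τ₁ p₀ q₀)
    (hπ₁ : IsInterpretation M₂ M₁ X₁ τ₁ X₂ τ₂ p₁ q₁) :
    IsInterpretation M₂ M₀ X₀ τ₀ X₂ τ₂ (comp X₀ X₂ p₁ p₀) (comp τ₀ τ₂ q₁ q₀) := by
  have h₀ := hπ₀.1
  have h₁ := hπ₁.1
  obtain ⟨Z, ζ, g, hP⟩ := hY.exists_isCechPresentation h₀.source hf hfs
  refine ((h₀.comp hM₁ hM₂ h₀₁ h₁₂ h₁).isInterpretation_iff hM₀ hM₂ (h₀₁.trans h₁₂)).2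
    fun F hFM hF => ?_
  obtain ⟨z, hz, hzF⟩ := (h₁.isInterpretation_iff hM₁ hM₂ h₁₂).1 hπ₁ _
    (hM₂.generatedFilter_mem (h₁₂ h₀.target.topology_mem) (h₁₂ h₀.opens_mem) hFM)
    (hπ₀.isPrimeFilter_generatedFilter hM₀ hM₁ h₀₁ hP hF)
  refine ⟨z, hz, fun O hO => ?_⟩
  rw [app_comp h₀.opens_isFunc h₁.opens_isFunc hO, hzF _ (app_mem h₀.opens_isFunc hO),
    h₀.app_mem_generatedFilter_iff hF.toIsOpenFilter hO]

theorem mainTheorem8 (M₀ M₁ : Set ZFSet.{u})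
    (hM₀ : TopInterp.IsTransitiveModel M₀) (hM₁ : TopInterp.IsTransitiveModel M₁)
    (hsub : M₀ ⊆ M₁)
    (X₀ τ₀ X₁ τ₁ X₂ τ₂ p₀ q₀ p₁ q₁ : ZFSet.{u})
    (hX₀ : TopInterp.IsInterpretable M₀ X₀ τ₀)
    (hπ₀ : TopInterp.IsInterpretation M₁ M₀ X₀ τ₀ X₁ τ₁ p₀ q₀)
    (hπ₁ : TopInterp.IsInterpretation Set.univ M₁ X₁ τ₁ X₂ τ₂ p₁ q₁) :
    TopInterp.IsInterpretation Set.univ M₀ X₀ τ₀ X₂ τ₂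
      (TopInterp.comp X₀ X₂ p₁ p₀) (TopInterp.comp τ₀ τ₂ q₁ q₀) := by
  obtain ⟨_, _, _, _, _, hY, _, hf, hfs⟩ := hX₀
  exact mainTheorem8_general hM₀ hM₁ TopInterp.isTransitiveModel_univ hsub (Set.subset_univ M₁)
    hY hf hfs hπ₀ hπ₁
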